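/- **Notation.** For $n\in\mathbb N=\{1,2,\dots\}$ and $x\in\mathbb R^n$ let $\lVert x\rVert_\infty=\max_i|x_i|$. Let $\mathbf d,\mathbf L\in\mathbb N$, $u<v$ real, $\mathbf l=(\mathbf l_0,\dots,\mathbf l_{\mathbf L})\in\mathbb N^{\mathbf L+1}$ with $\mathbf d\ge\sum_{i=1}^{\mathbf L}\mathbf l_i(\mathbf l_{i-1}+1)$. For $\theta\in\mathbb R^{\mathbf d}$, $s\in\mathbb N_0=\{0,1,2,\dots\}$, $m,n\in\mathbb N$ with $\mathbf d\ge s+mn+m$ let $\mathcal A^{\theta,s}_{m,n}\colon\mathbb R^n\to\mathbb R^m$ be the affine function whose $r$-th component is $\big[\sum_{i=1}^n\theta_{s+(r-1)n+i}\,x_i\big]+\theta_{s+mn+r}$. Let $\mathscr N^{\theta,\mathbf l}_{u,v}\colon\mathbb R^{\mathbf l_0}\to\mathbb R^{\mathbf l_{\mathbf L}}$ be the rectified clipped neural network $$\mathscr N^{\theta,\mathbf l}_{u,v}=\mathbf a_{\mathbf L}\circ\mathcal A^{\theta,s_{\mathbf L}}_{\mathbf l_{\mathbf L},\mathbf l_{\mathbf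 L-1}}\circ\mathbf a_{\mathbf L-1}\circ\dots\circ\mathbf a_1\circ\mathcal A^{\theta,s_1}_{\mathbf l_1,\mathbf l_0},\qquad s_i=\sum_{j=1}^{i-1}\mathbf l_j(\mathbf l_{j-1}+1),$$ where $\mathbf a_1,\dots,\mathbf a_{\mathbf L-1}$ apply $x\mapsto\max\{x,0\}$ in each coordinate and $\mathbf a_{\mathbf L}$ applies $x\mapsto\max\{u,\min\{x,v\}\}$ in each coordinate. **Proposition.** Let $d,\mathbf d,\mathbf L,M,K,N\in\mathbb N$, $b,c\in[1,\infty)$, $B\in[c,\infty)$, $u\in\mathbb R$, $v\in(u,\infty)$, $\mathbf l=(\mathbf l_0,\dots,\mathbf l_{\mathbf L})\in\mathbb N^{\mathbf L+1}$, $\mathbf N\subseteq\{0,1,\dots,N\}$, $D\subseteq[-b,b]^d$, and assume $0\in\mathbf N$, $\mathbf l_0=d$, $\mathbf l_{\mathbf L}=1$, $\mathbf d\ge\sum_{i=1}^{\mathbf L}\mathbf l_i(\mathbf l_{i-1}+1)$. Let $(\Omega,\mathcal F,\mathbb P)$ be a probability space, let $X_j\colon\Omega\to D$ and $Y_j\colon\Omega\to[u,v]$,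 $j\in\mathbb N$, be functions such that $(X_j,Y_j)$, $j\in\{1,\dots,M\}$, are i.i.d. random variables, let $\mathcal E\colon D\to[u,v]$ be Borel measurable with $\mathcal E(X_1)=\mathbb E[Y_1\mid X_1]$ $\mathbb P$-a.s. Let $\Theta_{k,n}\colon\Omega\to\mathbb R^{\mathbf d}$, $k,n\in\mathbb N_0$, and $\mathbf k\colon\Omega\to(\mathbb N_0)^2$ be random variables such that $\Theta_{k,0}(\Omega)\subseteq[-B,B]^{\mathbf d}$ for all $k\in\mathbb N$, such that $\Theta_{k,0}$, $k\in\{1,\dots,K\}$, are i.i.d., and such that $\Theta_{1,0}$ is continuous uniformly distributed on $[-c,c]^{\mathbf d}$. Let $\mathcal R\colon\mathbb R^{\mathbf d}\times\Omega\to[0,\infty)$ satisfy for all $\theta\in\mathbb R^{\mathbf d}$, $\omega\in\Omega$ that $$\mathcal R(\theta,\omega)=\frac1M\sum_{j=1}^M\big|\mathscr N^{\theta,\mathbf l}_{u,v}(X_j(\omega))-Y_j(\omega)\big|^2\quad\text{and}\quad\mathbf k(\omega)\in\operatorname*{arg\,min}_{(k,n)\in\{1,\dots,K\}\times\mathbf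 N,\ \lVert\Theta_{k,n}(\omega)\rVert_\infty\le B}\mathcal R(\Theta_{k,n}(\omega),\omega).$$ Then the integrals below are well defined and finite, and for all $p\in(0,\infty)$ $$\begin{aligned}&\Big(\mathbb E\Big[\Big(\int_D\big|\mathscr N^{\Theta_{\mathbf k},\mathbf l}_{u,v}(x)-\mathcal E(x)\big|^2\,\mathbb P_{X_1}(\mathrm dx)\Big)^p\Big]\Big)^{1/p}\\&\le\Big[\inf_{\theta\in[-c,c]^{\mathbf d}}\sup_{x\in D}\big|\mathscr N^{\theta,\mathbf l}_{u,v}(x)-\mathcal E(x)\big|^2\Big]+\frac{4(v-u)b\,\mathbf L(\lVert\mathbf l\rVert_\infty+1)^{\mathbf L}c^{\mathbf L}\max\{1,p\}}{K^{[\mathbf L^{-1}(\lVert\mathbf l\rVert_\infty+1)^{-2}]}}\\&\quad+\frac{18\max\{1,(v-u)^2\}\mathbf L(\lVert\mathbf l\rVert_\infty+1)^2\max\{p,\ln(3MBb)\}}{\sqrt M}\\&\le\Big[\inf_{\theta\in[-c,c]^{\mathbf d}}\sup_{x\in D}\big|\mathscr N^{\theta,\mathbf l}_{u,v}(x)-\mathcal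 E(x)\big|^2\Big]+\frac{20\max\{1,(v-u)^2\}\,b\,\mathbf L(\lVert\mathbf l\rVert_\infty+1)^{\mathbf L+1}B^{\mathbf L}\max\{p,\ln(3M)\}}{\min\{\sqrt M,\,K^{[\mathbf L^{-1}(\lVert\mathbf l\rVert_\infty+1)^{-2}]}\}}.\end{aligned}$$ -/

import Mathlib

open MeasureTheory ProbabilityTheory

namespace ClippedDNN

/-- The `i`-th entry (counted from `0`) of the parameter vector `θ ∈ ℝ^n`. Entries past the end are
`0`; a parameter vector that is long enough for the architecture never has them read. -/
noncomputable def param {n : ℕ} (θ : Fin n → ℝ) (i : ℕ) : ℝ :=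
  if h : i < n then θ ⟨i, h⟩ else 0

/-- The affine function `ℝ^n → ℝ^m` whose `m × n` weight matrix is stored row by row in `θ` from
position `s` on, directly followed by its bias vector of length `m`. -/
noncomputable def affine {dPar : ℕ} (θ : Fin dPar → ℝ) (s m n : ℕ) (x : Fin n → ℝ) : Fin m → ℝ :=
  fun r => (∑ q : Fin n, param θ (s + r * n + q) * x q) + param θ (s + m * n + r)

/-- The number of parameters of the `i`-th affine function (`i = 0, …, L - 1`), which maps
`ℝ^(l i)` to `ℝ^(l (i + 1))`. -/
def layerSize {L : ℕ} (l : Fin (L + 1) → ℕ) (i : Fin L) : ℕ :=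
  l i.succ * (l i.castSucc + 1)

/-- The fully connected feedforward network
`a_L ∘ A_L ∘ a_(L-1) ∘ A_(L-1) ∘ ⋯ ∘ a_1 ∘ A_1` with layer dimensions `l 0, …, l L`,
where the parameters of `A_1, …, A_L` are stored consecutively in `θ` from position `s` on. Here
`A_(i+1)` and `a_(i+1)` belong to the index `i : Fin L`. -/
noncomputable def network {dPar L : ℕ} (θ : Fin dPar → ℝ) (s : ℕ) (l : Fin (L + 1) → ℕ)
    (a : (i : Fin L) → (Fin (l i.succ) → ℝ) → (Fin (l i.succ) → ℝ))
    (x : Fin (l 0) → ℝ) : Fin (l (Fin.last L)) → ℝ :=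
  Fin.induction (motive := fun i : Fin (L + 1) => Fin (l i) → ℝ) x
    (fun i y =>
      a i (affine θ (s + ∑ j ∈ Finset.Iio i, layerSize l j) (l i.succ) (l i.castSucc) y))
    (Fin.last L)

/-- The multidimensional version of a function `a : ℝ → ℝ`: `a` in every coordinate. -/
def multidim (a : ℝ → ℝ) (n : ℕ) (x : Fin n → ℝ) : Fin n → ℝ := fun i => a (x i)

/-- The rectifier function. -/
noncomputable def rect (x : ℝ) : ℝ := max x 0

/-- The clipping function with values in `[u, v]`. -/
noncomputable def clip (u v x : ℝ) : ℝ := max u (min x v)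

/-- The rectified clipped network: rectifier after every affine function but the last, clipping
to `[u, v]` after the last one. -/
noncomputable def clippedNN {dPar L : ℕ} (θ : Fin dPar → ℝ) (l : Fin (L + 1) → ℕ) (u v : ℝ) :
    (Fin (l 0) → ℝ) → (Fin (l (Fin.last L)) → ℝ) :=
  network θ 0 l (fun i =>
    if (i : ℕ) + 1 = L then multidim (clip u v) (l i.succ) else multidim rect (l i.succ))

/-- The rectified clipped network as a function `ℝ^d → ℝ`, for `l 0 = d` and `l L = 1`. -/
noncomputable def realNN {d dPar L : ℕ} {l : Fin (L + 1) → ℕ} (h0 : l 0 = d)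
    (hL : l (Fin.last L) = 1) (u v : ℝ) (θ : Fin dPar → ℝ) (x : Fin d → ℝ) : ℝ :=
  clippedNN θ l u v (fun i => x (Fin.cast h0 i)) (Fin.cast hL.symm 0)

/-- The maximum norm of the vector of layer dimensions (the norm of `Fin (L + 1) → ℝ` is the
maximum norm). -/
noncomputable def archNorm {L : ℕ} (l : Fin (L + 1) → ℕ) : ℝ := ‖(fun i => (l i : ℝ))‖

/-- The cube `[-r, r]^n`. -/
def cube (n : ℕ) (r : ℝ) : Set (Fin n → ℝ) := {x | ∀ i, x i ∈ Set.Icc (-r) r}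

/-- The set of minimisers of `f` over `S`. -/
def argminOn {α : Type*} (S : Set α) (f : α → ℝ) : Set α := {x | x ∈ S ∧ ∀ y ∈ S, f x ≤ f y}

/-- `Z j`, `j ∈ s`, are independent and identically distributed random variables. -/
def IsIIDOn {Ω E : Type*} [MeasurableSpace Ω] [MeasurableSpace E] (s : Set ℕ) (Z : ℕ → Ω → E)
    (μ : Measure Ω) : Prop :=
  (∀ j ∈ s, Measurable (Z j)) ∧ iIndepFun (fun j : s => Z j) μ ∧
    ∀ i ∈ s, ∀ j ∈ s, IdentDistrib (Z i) (Z j) μ μ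

/-- `inf_{θ ∈ [-c, c]^dPar} sup_{x ∈ D} |NN_θ(x) - E(x)|²`, for a family `NN` of functions. -/
noncomputable def approxError {d dPar : ℕ} (D : Set (Fin d → ℝ)) (c : ℝ)
    (NN : (Fin dPar → ℝ) → (Fin d → ℝ) → ℝ) (E : D → ℝ) : ℝ :=
  ⨅ θ : cube dPar c, ⨆ x : D, |NN θ x - E x| ^ 2

end ClippedDNN

namespace ClippedDNN

/-! Write `A = archNorm l + 1`, and let `n` be the number of parameters that the architecture reads.
For a fixed parameter `ϑ` in the cube of radius `c`, the bias-variance identity `integral_sq_sub_eq`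
turns differences of squared L²-distances to `E` into differences of true risks. Passing from true
to empirical risk at the selected parameter and at `ϑ`, and using that the selected parameter has
empirical risk at most that of every initialisation, bounds the error by three terms: the
approximation error of `ϑ`, twice the uniform deviation of empirical from true risk over the cube of
radius `B`, and the empirical risk lost in replacing `ϑ` by the nearest of the `K` initialisations.

Optimisation: the network is Lipschitz in its parameters on cubes (`abs_realNN_sub_le`), so the
third term is governed by the distance from `ϑ` to the nearest initialisation. A uniform vector lies
within `t` of `ϑ` in the `n` relevant coordinates with probability at least `(t/(2c))^n`.
Independence gives the tail `exp(-K (t/(2c))^n)`, whose moments are of order `K^(-1/n)`.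

Generalisation: on a grid of `m^n` parameters the deviations are sub-Gaussian with parameter
`(v-u)²/(2√M)` by Hoeffding's lemma, so their maximum has `L^q`-norm of order `√q/√M` once `q ≥
log(2 m^n)` (`integral_sup_rpow_le`). The Lipschitz bound extends this to the whole cube
(`exists_uniform_deviation`).

`integral_error_rpow_le` adds the three terms by Minkowski's inequality in `L^P` with `P = max 1 p`
and then descends to `L^p`. What remains is to choose `m` and `q` and to compare constants. -/

/-- The output of the first `i` layers of the rectified clipped network. -/
noncomputable def layerOut {dPar L : ℕ} (θ : Fin dPar → ℝ) (l : Fin (L + 1) → ℕ) (u v : ℝ)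
    (x : Fin (l 0) → ℝ) (i : Fin (L + 1)) : Fin (l i) → ℝ :=
  Fin.induction (motive := fun i : Fin (L + 1) => Fin (l i) → ℝ) x
    (fun i y => (if (i : ℕ) + 1 = L then multidim (clip u v) (l i.succ)
        else multidim rect (l i.succ))
      (affine θ (0 + ∑ j ∈ Finset.Iio i, layerSize l j) (l i.succ) (l i.castSucc) y)) i

/-! ### Regularity of the network and its Lipschitz dependence on the parameters. -/

section Network

variable {dPar L : ℕ} {l : Fin (L + 1) → ℕ} {u v : ℝ}

lemma layerOut_zero (θ : Fin dPar → ℝ) (x : Fin (l 0) → ℝ) : layerOut θ l u v x 0 = x := rfl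

lemma layerOut_succ (θ : Fin dPar → ℝ) (x : Fin (l 0) → ℝ) (i : Fin L) (r : Fin (l i.succ)) :
    layerOut θ l u v x i.succ r = (if (i : ℕ) + 1 = L then clip u v else rect)
      (affine θ (∑ j ∈ Finset.Iio i, layerSize l j) (l i.succ) (l i.castSucc)
        (layerOut θ l u v x i.castSucc) r) := by
  have h : layerOut θ l u v x i.succ = (if (i : ℕ) + 1 = L then multidim (clip u v) (l i.succ)
        else multidim rect (l i.succ))
      (affine θ (0 + ∑ j ∈ Finset.Iio i, layerSize l j) (l i.succ) (l i.castSucc)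
        (layerOut θ l u v x i.castSucc)) := by
    rw [layerOut, Fin.induction_succ]; rfl
  rw [h, zero_add]
  split_ifs <;> rfl

lemma realNN_eq_layerOut {d : ℕ} (h0 : l 0 = d) (hL : l (Fin.last L) = 1) (θ : Fin dPar → ℝ)
    (x : Fin d → ℝ) : realNN h0 hL u v θ x =
      layerOut θ l u v (fun i => x (Fin.cast h0 i)) (Fin.last L) (Fin.cast hL.symm 0) := rfl

lemma continuous_clip : Continuous (clip u v) := by unfold clip; fun_prop

lemma continuous_rect : Continuous rect := by unfold rect; fun_prop

lemma continuous_param (i : ℕ) : Continuous fun θ : Fin dPar → ℝ => param θ i := by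
  unfold param
  split_ifs <;> fun_prop

lemma continuous_layerOut (i : Fin (L + 1)) :
    Continuous fun z : (Fin dPar → ℝ) × (Fin (l 0) → ℝ) => layerOut z.1 l u v z.2 i := by
  induction i using Fin.induction with
  | zero => simpa only [layerOut_zero] using continuous_snd
  | succ i ih =>
    refine continuous_pi fun r => ?_
    simp only [layerOut_succ]
    have h : Continuous (if (i : ℕ) + 1 = L then clip u v else rect) := by
      split_ifs
      exacts [continuous_clip, continuous_rect]
    refine h.comp ?_
    unfold affine
    have hp (k : ℕ) : Continuous fun z : (Fin dPar → ℝ) × (Fin (l 0) → ℝ) => param z.1 k :=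
      (continuous_param k).comp continuous_fst
    refine (continuous_finsetSum _ fun q _ => (hp _).mul ?_).add (hp _)
    exact (continuous_apply q).comp ih

lemma continuous_realNN {d : ℕ} (h0 : l 0 = d) (hL : l (Fin.last L) = 1) :
    Continuous fun z : (Fin dPar → ℝ) × (Fin d → ℝ) => realNN h0 hL u v z.1 z.2 := by
  simp only [realNN_eq_layerOut]
  have h : Continuous fun z : (Fin dPar → ℝ) × (Fin d → ℝ) =>
      (z.1, fun i : Fin (l 0) => z.2 (Fin.cast h0 i)) := by fun_prop
  exact (continuous_apply _).comp ((continuous_layerOut (Fin.last L)).comp h)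

lemma clip_mem_Icc (huv : u ≤ v) (x : ℝ) : clip u v x ∈ Set.Icc u v :=
  ⟨le_max_left _ _, max_le huv (min_le_right _ _)⟩

lemma realNN_mem_Icc {d : ℕ} (hL1 : 1 ≤ L) (huv : u ≤ v) (h0 : l 0 = d)
    (hL : l (Fin.last L) = 1) (θ : Fin dPar → ℝ) (x : Fin d → ℝ) :
    realNN h0 hL u v θ x ∈ Set.Icc u v := by
  obtain ⟨L, rfl⟩ : ∃ L', L = L' + 1 := ⟨L - 1, by omega⟩
  rw [realNN_eq_layerOut]
  have := layerOut_succ (u := u) (v := v) θ (fun i => x (Fin.cast h0 i)) (Fin.last L)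
    (Fin.cast hL.symm 0)
  simp only [Fin.val_last, if_true] at this
  erw [this]
  exact clip_mem_Icc huv _

lemma abs_clip_sub_clip_le (x y : ℝ) : |clip u v x - clip u v y| ≤ |x - y| := by
  unfold clip
  rw [max_comm u, max_comm u]
  exact (abs_max_sub_max_le_abs _ _ _).trans (abs_inf_sub_inf_le_abs _ _ _)

lemma abs_rect_sub_rect_le (x y : ℝ) : |rect x - rect y| ≤ |x - y| :=
  abs_max_sub_max_le_abs _ _ _

lemma abs_rect_le (x : ℝ) : |rect x| ≤ |x| := by
  simpa [rect] using abs_rect_sub_rect_le x 0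

lemma layer_offset_add_le (i : Fin L) :
    ∑ j ∈ Finset.Iio i, layerSize l j + layerSize l i ≤ ∑ j, layerSize l j := by
  rw [add_comm, ← Finset.sum_insert (by simp)]
  exact Finset.sum_le_sum_of_subset (Finset.subset_univ _)

/-- Together with `bias_index_lt` this confines the network to the first `∑ layerSize` entries of
the parameter vector, so that no later rate depends on `dPar`. -/
lemma weight_index_lt (i : Fin L) (r : Fin (l i.succ)) (q : Fin (l i.castSucc)) :
    ∑ j ∈ Finset.Iio i, layerSize l j + r * l i.castSucc + q < ∑ j, layerSize l j := by
  refine lt_of_lt_of_le ?_ (layer_offset_add_le i)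
  have h1 : ((r : ℕ) + 1) * l i.castSucc ≤ l i.succ * l i.castSucc :=
    Nat.mul_le_mul_right _ r.2
  have h2 := q.2
  have h3 := r.2
  simp only [layerSize]
  nlinarith

lemma bias_index_lt (i : Fin L) (r : Fin (l i.succ)) :
    ∑ j ∈ Finset.Iio i, layerSize l j + l i.succ * l i.castSucc + r < ∑ j, layerSize l j := by
  refine lt_of_lt_of_le ?_ (layer_offset_add_le i)
  have h3 := r.2
  simp only [layerSize]
  nlinarith

lemma le_archNorm (i : Fin (L + 1)) : (l i : ℝ) ≤ archNorm l := by
  have := norm_le_pi_norm (fun i => (l i : ℝ)) i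
  simpa [archNorm] using this

lemma one_le_archNorm (hl : ∀ i, 1 ≤ l i) : 1 ≤ archNorm l :=
  le_trans (by exact_mod_cast hl 0) (le_archNorm 0)

lemma sum_layerSize_le :
    ((∑ i, layerSize l i : ℕ) : ℝ) ≤ L * (archNorm l * (archNorm l + 1)) := by
  push_cast
  calc ∑ i, (layerSize l i : ℝ) ≤ ∑ _i : Fin L, archNorm l * (archNorm l + 1) := by
        refine Finset.sum_le_sum fun i _ => ?_
        have h1 := le_archNorm (l := l) i.succ
        have h2 := le_archNorm (l := l) i.castSucc
        rw [layerSize]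
        push_cast
        exact mul_le_mul h1 (by linarith) (by positivity) (le_trans (by positivity) h1)
    _ = _ := by simp

/-- Since `t ≥ 1`, the bias costs at most `c * t`, like one further weight; hence the factor
`archNorm l + 1`. -/
lemma abs_affine_le {θ : Fin dPar → ℝ} {c t : ℝ} (hc : 0 ≤ c) (ht : 1 ≤ t)
    (hθ : ∀ j < ∑ j, layerSize l j, |param θ j| ≤ c) (i : Fin L) (y : Fin (l i.castSucc) → ℝ)
    (hy : ∀ q, |y q| ≤ t) (r : Fin (l i.succ)) :
    |affine θ (∑ j ∈ Finset.Iio i, layerSize l j) (l i.succ) (l i.castSucc) y r|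
      ≤ (archNorm l + 1) * c * t := by
  calc _ ≤ ∑ _q : Fin (l i.castSucc), c * t + c := by
        refine (abs_add_le _ _).trans (add_le_add ?_ (hθ _ (bias_index_lt i r)))
        refine (Finset.abs_sum_le_sum_abs _ _).trans (Finset.sum_le_sum fun q _ => ?_)
        rw [abs_mul]
        exact mul_le_mul (hθ _ (weight_index_lt i r q)) (hy q) (abs_nonneg _) hc
    _ = l i.castSucc * (c * t) + c := by simp
    _ ≤ archNorm l * (c * t) + c * t := by
        gcongr
        · exact le_archNorm _
        · nlinarith
    _ = _ := by ring

lemma abs_affine_sub_le {θ ϑ : Fin dPar → ℝ} {c t ε δ : ℝ} (hc : 0 ≤ c) (ht : 1 ≤ t)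
    (hε : 0 ≤ ε) (hδ : 0 ≤ δ)
    (hθ : ∀ j < ∑ j, layerSize l j, |param θ j| ≤ c)
    (hd : ∀ j < ∑ j, layerSize l j, |param θ j - param ϑ j| ≤ ε)
    (i : Fin L) (y z : Fin (l i.castSucc) → ℝ)
    (hz : ∀ q, |z q| ≤ t) (hyz : ∀ q, |y q - z q| ≤ δ) (r : Fin (l i.succ)) :
    |affine θ (∑ j ∈ Finset.Iio i, layerSize l j) (l i.succ) (l i.castSucc) y r
      - affine ϑ (∑ j ∈ Finset.Iio i, layerSize l j) (l i.succ) (l i.castSucc) z r|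
      ≤ (archNorm l + 1) * (c * δ + ε * t) := by
  unfold affine
  rw [add_sub_add_comm, ← Finset.sum_sub_distrib]
  calc _ ≤ ∑ _q : Fin (l i.castSucc), (c * δ + ε * t) + ε := by
        refine (abs_add_le _ _).trans (add_le_add ?_ (hd _ (bias_index_lt i r)))
        refine (Finset.abs_sum_le_sum_abs _ _).trans (Finset.sum_le_sum fun q _ => ?_)
        have hidx := weight_index_lt i r q
        generalize ∑ j ∈ Finset.Iio i, layerSize l j + r * l i.castSucc + q = k at hidx
        rw [show param θ k * y q - param ϑ k * z q
          = param θ k * (y q - z q) + (param θ k - param ϑ k) * z q by ring]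
        refine (abs_add_le _ _).trans ?_
        rw [abs_mul, abs_mul]
        exact add_le_add (mul_le_mul (hθ _ hidx) (hyz q) (abs_nonneg _) hc)
          (mul_le_mul (hd _ hidx) (hz q) (abs_nonneg _) hε)
    _ = l i.castSucc * (c * δ + ε * t) + ε := by simp [mul_add]
    _ ≤ archNorm l * (c * δ + ε * t) + (c * δ + ε * t) := by
        gcongr
        · exact le_archNorm _
        · nlinarith [mul_nonneg hc hδ]
    _ = _ := by ring

/-- A joint induction: the error obeys `δ_(i+1) ≤ A (c δ_i + ε t_i)`, where `t_i = b (A c)^i` bounds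
the layer outputs. The size bound stops before the last layer because clipping, unlike the
rectifier, need not decrease absolute values; the difference bound survives because clipping is
1-Lipschitz. -/
lemma layerOut_bounds (hl : ∀ i, 1 ≤ l i) {θ ϑ : Fin dPar → ℝ} {b c ε : ℝ} (hb : 1 ≤ b)
    (hc : 1 ≤ c) (hε : 0 ≤ ε)
    (hθ : ∀ j < ∑ j, layerSize l j, |param θ j| ≤ c)
    (hϑ : ∀ j < ∑ j, layerSize l j, |param ϑ j| ≤ c)
    (hd : ∀ j < ∑ j, layerSize l j, |param θ j - param ϑ j| ≤ ε)
    {x : Fin (l 0) → ℝ} (hx : ∀ i, |x i| ≤ b) (i : Fin (L + 1)) :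
    ((i : ℕ) < L → ∀ r, |layerOut ϑ l u v x i r| ≤ b * ((archNorm l + 1) * c) ^ (i : ℕ)) ∧
    ∀ r, |layerOut θ l u v x i r - layerOut ϑ l u v x i r|
      ≤ i * b * (archNorm l + 1) ^ (i : ℕ) * c ^ ((i : ℕ) - 1) * ε := by
  have ha := one_le_archNorm hl
  have hc0 : 0 ≤ c := by linarith
  induction i using Fin.induction with
  | zero => simpa [layerOut_zero] using fun _ => hx
  | succ i ih =>
    obtain ⟨ih1, ih2⟩ := ih
    have ih1 := ih1 i.2
    have hA : 1 ≤ (archNorm l + 1) * c := by nlinarith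
    have ht : 1 ≤ b * ((archNorm l + 1) * c) ^ (i.castSucc : ℕ) := by
      nlinarith [one_le_pow₀ hA (n := (i.castSucc : ℕ))]
    refine ⟨fun hi r => ?_, fun r => ?_⟩
    · rw [layerOut_succ, if_neg (by simpa using hi.ne)]
      refine (abs_rect_le _).trans ((abs_affine_le hc0 ht hϑ i _ ih1 r).trans_eq ?_)
      simp only [Fin.val_succ, Fin.val_castSucc]
      ring
    · rw [layerOut_succ, layerOut_succ]
      have key := abs_affine_sub_le hc0 ht hε
        (by positivity) hθ hd i _ _ ih1 ih2 r
      have e : (archNorm l + 1) * (c * ((i.castSucc : ℕ) * b * (archNorm l + 1) ^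
          (i.castSucc : ℕ) * c ^ ((i.castSucc : ℕ) - 1) * ε)
          + ε * (b * ((archNorm l + 1) * c) ^ (i.castSucc : ℕ)))
          = (i.succ : ℕ) * b * (archNorm l + 1) ^ (i.succ : ℕ) * c ^ ((i.succ : ℕ) - 1) * ε := by
        simp only [Fin.val_succ, Fin.val_castSucc, Nat.add_sub_cancel]
        -- For `i = 0` the truncated exponent `i - 1` is wrong by one, but its term carries the
        -- factor `i`; otherwise `c * c^(i-1) = c^i`.
        rcases Nat.eq_zero_or_pos (i : ℕ) with h | h
        · rw [h]; simp; ring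
        · obtain ⟨k, hk⟩ : ∃ k, (i : ℕ) = k + 1 := ⟨i - 1, by omega⟩
          rw [hk, Nat.add_sub_cancel, mul_pow]; push_cast; ring
      rw [← e]
      refine le_trans ?_ key
      split_ifs
      exacts [abs_clip_sub_clip_le _ _, abs_rect_sub_rect_le _ _]

/-- Local Lipschitz continuity of the realisation in the parameters that are used. -/
lemma abs_realNN_sub_le {d : ℕ} (h0 : l 0 = d) (hL : l (Fin.last L) = 1) (hl : ∀ i, 1 ≤ l i)
    {θ ϑ : Fin dPar → ℝ} {b c ε : ℝ} (hb : 1 ≤ b) (hc : 1 ≤ c) (hε : 0 ≤ ε)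
    (hθ : ∀ j < ∑ j, layerSize l j, |param θ j| ≤ c)
    (hϑ : ∀ j < ∑ j, layerSize l j, |param ϑ j| ≤ c)
    (hd : ∀ j < ∑ j, layerSize l j, |param θ j - param ϑ j| ≤ ε)
    {x : Fin d → ℝ} (hx : x ∈ cube d b) :
    |realNN h0 hL u v θ x - realNN h0 hL u v ϑ x|
      ≤ L * b * (archNorm l + 1) ^ L * c ^ (L - 1) * ε := by
  rw [realNN_eq_layerOut, realNN_eq_layerOut]
  exact (layerOut_bounds hl hb hc hε hθ hϑ hd (fun i => abs_le.2 (hx _)) (Fin.last L)).2 _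

lemma abs_param_le_of_mem_cube {θ : Fin dPar → ℝ} {c : ℝ} (hc : 0 ≤ c) (hθ : θ ∈ cube dPar c)
    (j : ℕ) : |param θ j| ≤ c := by
  unfold param
  split_ifs
  exacts [abs_le.2 (hθ _), by simpa using hc]

end Network

/-! ### A bound for the Gamma function and inequalities for real powers. -/

section RealInequalities

lemma Gamma_one_add_le_one {x : ℝ} (h0 : 0 ≤ x) (h1 : x ≤ 1) : Real.Gamma (1 + x) ≤ 1 := by
  have h := Real.convexOn_Gamma.2 (show (1 : ℝ) ∈ Set.Ioi 0 by simp)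
    (show (2 : ℝ) ∈ Set.Ioi 0 by simp) (sub_nonneg.2 h1) h0 (by ring)
  simp only [smul_eq_mul, Real.Gamma_one, Real.Gamma_two] at h
  calc Real.Gamma (1 + x) = Real.Gamma ((1 - x) * 1 + x * 2) := by ring_nf
    _ ≤ _ := h
    _ = 1 := by ring

/-- On `[0, 1]` convexity and `Γ(1) = Γ(2) = 1` suffice; beyond, the functional equation `Γ(1+x) = x
Γ(x)` lowers `x` by one, whence the induction on an integer bound. -/
lemma Gamma_one_add_le {x : ℝ} (hx : 0 ≤ x) : Real.Gamma (1 + x) ≤ max 1 x ^ x := by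
  obtain ⟨k, hk⟩ := exists_nat_ge x
  induction k generalizing x with
  | zero =>
    have : x = 0 := le_antisymm (by simpa using hk) hx
    simp [this]
  | succ k ih =>
    rcases le_total x 1 with h | h
    · rw [max_eq_left h, Real.one_rpow]
      exact Gamma_one_add_le_one hx h
    · have hx0 : 0 < x := by linarith
      rw [add_comm, Real.Gamma_add_one hx0.ne', max_eq_right h]
      have h1 := ih (x := x - 1) (by linarith) (by push_cast at hk; linarith)
      rw [add_sub_cancel] at h1
      calc x * Real.Gamma x ≤ x * max 1 (x - 1) ^ (x - 1) := by gcongr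
        _ ≤ x * x ^ (x - 1) := by
          have : max 1 (x - 1) ≤ x := max_le h (by linarith)
          gcongr
        _ = x ^ x := by
          nth_rewrite 1 [← Real.rpow_one x]
          rw [← Real.rpow_add hx0]
          ring_nf

/-- The constant is the maximum of `s^q exp(-lam s)`, attained at `s = q/lam`; it comes from `y ≤
exp(y - 1)` at `y = lam s/q`. -/
lemma rpow_le_mul_exp {s q lam : ℝ} (hs : 0 ≤ s) (hq : 0 < q) (hlam : 0 < lam) :
    s ^ q ≤ (q / (Real.exp 1 * lam)) ^ q * Real.exp (lam * s) := by
  have h1 : s ≤ q / (Real.exp 1 * lam) * Real.exp (lam * s / q) := by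
    have h := Real.add_one_le_exp (lam * s / q - 1)
    rw [sub_add_cancel, Real.exp_sub] at h
    have e := Real.exp_pos 1
    calc s = q / lam * (lam * s / q) := by field_simp
      _ ≤ q / lam * (Real.exp (lam * s / q) / Real.exp 1) := by gcongr
      _ = _ := by field_simp
  calc s ^ q ≤ (q / (Real.exp 1 * lam) * Real.exp (lam * s / q)) ^ q := by gcongr
    _ = _ := by
      rw [Real.mul_rpow (by positivity) (by positivity), ← Real.exp_mul]
      congr 2
      field_simp

/-- Convexity of the `P`-th power, applied to the mean of `1, x/α, y/β` with weights proportional to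
`a, α, β`. Integrated, it yields Minkowski's inequality with prescribed bounds `α, β` on the norms.
-/
lemma rpow_add_three_le {a α β x y P : ℝ} (ha : 0 < a) (hα : 0 < α) (hβ : 0 < β) (hx : 0 ≤ x)
    (hy : 0 ≤ y) (hP : 1 ≤ P) :
    (a + x + y) ^ P ≤ (a + α + β) ^ P *
      (a / (a + α + β) + α / (a + α + β) * (x ^ P / α ^ P) + β / (a + α + β) * (y ^ P / β ^ P)) := by
  set S := a + α + β with hS
  have hS0 : 0 < S := by positivity
  have h := Real.rpow_arith_mean_le_arith_mean_rpow Finset.univ ![a / S, α / S, β / S]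
    ![1, x / α, y / β] (by intro i _; fin_cases i <;> simp <;> positivity)
    (by simp [Fin.sum_univ_three]; field_simp; exact hS.symm)
    (by intro i _; fin_cases i <;> simp <;> positivity) hP
  simp only [Fin.sum_univ_three, Matrix.cons_val_zero, Matrix.cons_val_one, Matrix.cons_val,
    Real.one_rpow, Real.div_rpow hx hα.le, Real.div_rpow hy hβ.le, mul_one] at h
  calc (a + x + y) ^ P = (S * (a / S + α / S * (x / α) + β / S * (y / β))) ^ P := by
        congr 1; field_simp
    _ = S ^ P * (a / S + α / S * (x / α) + β / S * (y / β)) ^ P :=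
        Real.mul_rpow hS0.le (by positivity)
    _ ≤ _ := by gcongr

end RealInequalities

/-! ### Moment bounds from tails and moment generating functions, and `L^p` comparison. -/

section Moments

variable {Ω : Type*} [MeasurableSpace Ω] {μ : Measure Ω}

/-- Moments of a random variable with a stretched exponential tail. -/
lemma integral_rpow_le_of_tail {Z : Ω → ℝ} (hZ : ∀ ω, 0 ≤ Z ω) (hZm : Measurable Z) {n : ℕ}
    (hn : 1 ≤ n) {κ P : ℝ} (hκ : 0 < κ) (hP : 1 ≤ P)
    (htail : ∀ t, 0 < t → μ {ω | t < Z ω} ≤ ENNReal.ofReal (Real.exp (-κ * t ^ n))) :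
    ∫ ω, Z ω ^ P ∂μ ≤ (P * κ ^ (-(1 / (n : ℝ)))) ^ P := by
  have hn0 : (0 : ℝ) < n := by exact_mod_cast hn
  have hn1 : (1 : ℝ) ≤ n := by exact_mod_cast hn
  have hP0 : 0 < P := by linarith
  have hint : IntegrableOn (fun t : ℝ => t ^ (P - 1) * Real.exp (-κ * t ^ (n : ℝ)))
      (Set.Ioi 0) := integrableOn_rpow_mul_exp_neg_mul_rpow (by linarith) hn0 hκ
  -- Layer-cake formula, with the assumed tail inserted.
  have h1 : ∫⁻ ω, ENNReal.ofReal (Z ω ^ P) ∂μ ≤ ENNReal.ofReal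
      (P * ∫ t in Set.Ioi (0 : ℝ), t ^ (P - 1) * Real.exp (-κ * t ^ (n : ℝ))) := by
    rw [lintegral_rpow_eq_lintegral_meas_lt_mul μ (ae_of_all _ hZ) hZm.aemeasurable hP0,
      ENNReal.ofReal_mul hP0.le, ofReal_integral_eq_lintegral_ofReal hint]
    · gcongr 1
      refine setLIntegral_mono_ae' measurableSet_Ioi (ae_of_all _ fun t ht => ?_)
      rw [mul_comm, ENNReal.ofReal_mul (Real.rpow_nonneg (le_of_lt ht) _)]
      gcongr
      simpa using htail t ht
    · refine (ae_restrict_iff' measurableSet_Ioi).2 (ae_of_all _ fun t ht => ?_)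
      exact mul_nonneg (Real.rpow_nonneg (le_of_lt ht) _) (Real.exp_pos _).le
  rw [integral_eq_lintegral_of_nonneg_ae (ae_of_all _ fun ω => Real.rpow_nonneg (hZ ω) _)
    (hZm.pow_const _).aestronglyMeasurable]
  refine ENNReal.toReal_le_of_le_ofReal (by positivity) (h1.trans (ENNReal.ofReal_le_ofReal ?_))
  rw [integral_rpow_mul_exp_neg_mul_rpow hn0 (by linarith) hκ, sub_add_cancel]
  have hx : 0 < P / n := by positivity
  -- The integral evaluates to `κ^(-P/n) * Γ(1 + P/n)`, and `P/n ≤ P` allows the Gamma factor to be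
  -- replaced by `P^P`.
  have hG : P / n * Real.Gamma (P / n) ≤ P ^ P := by
    rw [← Real.Gamma_add_one hx.ne', add_comm]
    have hPn : P / n ≤ P := div_le_self hP0.le hn1
    calc _ ≤ max 1 (P / n) ^ (P / n) := Gamma_one_add_le hx.le
      _ ≤ P ^ (P / n) := by gcongr; exact max_le hP hPn
      _ ≤ P ^ P := Real.rpow_le_rpow_of_exponent_le hP hPn
  calc P * (κ ^ (-P / n) * (1 / n) * Real.Gamma (P / n))
      = κ ^ (-P / n) * (P / n * Real.Gamma (P / n)) := by ring
    _ ≤ κ ^ (-P / n) * P ^ P := by gcongr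
    _ = _ := by
      rw [Real.mul_rpow hP0.le (by positivity), ← Real.rpow_mul hκ.le, mul_comm]
      congr 2
      ring

/-- Moments of the maximum of finitely many sub-Gaussian random variables. -/
lemma integral_sup_rpow_le {ι : Type*} [Fintype ι] [Nonempty ι] {S : ι → Ω → ℝ} {σ q : ℝ}
    (hσ : 0 < σ) (hq : 0 < q) (hqι : Real.log (2 * Fintype.card ι) ≤ q)
    (hSm : ∀ i, Measurable (S i))
    (hS : ∀ i, HasSubgaussianMGF (S i) (Real.toNNReal (σ ^ 2)) μ) :
    Measurable (fun ω => Finset.univ.sup' Finset.univ_nonempty fun i => |S i ω|) ∧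
    Integrable (fun ω => (Finset.univ.sup' Finset.univ_nonempty fun i => |S i ω|) ^ q) μ ∧
    ∫ ω, (Finset.univ.sup' Finset.univ_nonempty fun i => |S i ω|) ^ q ∂μ
      ≤ (2 * σ * √q) ^ q := by
  -- With this choice each exponential moment is at most `exp(q/2)`, and the union over signs and
  -- indices costs `2 * card ι ≤ exp q`. Since `C = (σ √q / e)^q`, the total is `(σ √q e^(1/2))^q`,
  -- and `e^(1/2) ≤ 2`.
  set lam := √q / σ with hlam
  have hq' : 0 < √q := Real.sqrt_pos.2 hq
  have hlam0 : 0 < lam := by positivity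
  set C := (q / (Real.exp 1 * lam)) ^ q with hC
  have hC0 : 0 ≤ C := by positivity
  have hi (i : ι) (t : ℝ) := (hS i).integrable_exp_mul t
  have hIi (i : ι) : Integrable
      (fun ω => C * (Real.exp (lam * S i ω) + Real.exp (-lam * S i ω))) μ :=
    ((hi i lam).add (hi i (-lam))).const_mul _
  have hI : Integrable (fun ω => ∑ i, C * (Real.exp (lam * S i ω) + Real.exp (-lam * S i ω))) μ :=
    integrable_finsetSum _ fun i _ => hIi i
  have hpt (ω : Ω) : (Finset.univ.sup' Finset.univ_nonempty fun i => |S i ω|) ^ q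
      ≤ ∑ i, C * (Real.exp (lam * S i ω) + Real.exp (-lam * S i ω)) := by
    obtain ⟨i, -, h⟩ := Finset.exists_mem_eq_sup' Finset.univ_nonempty fun i => |S i ω|
    rw [h]
    refine (rpow_le_mul_exp (abs_nonneg _) hq hlam0).trans ?_
    have h1 : Real.exp (lam * |S i ω|) ≤ Real.exp (lam * S i ω) + Real.exp (-lam * S i ω) := by
      rcases abs_cases (S i ω) with ⟨h, -⟩ | ⟨h, -⟩ <;> rw [h]
      · linarith [Real.exp_pos (-lam * S i ω)]
      · rw [mul_neg, neg_mul]; linarith [Real.exp_pos (lam * S i ω)]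
    calc _ ≤ C * (Real.exp (lam * S i ω) + Real.exp (-lam * S i ω)) := by gcongr
      _ ≤ _ := Finset.single_le_sum
        (f := fun i => C * (Real.exp (lam * S i ω) + Real.exp (-lam * S i ω)))
        (fun i _ => by positivity) (Finset.mem_univ i)
  have hnn (ω : Ω) : 0 ≤ Finset.univ.sup' Finset.univ_nonempty fun i => |S i ω| :=
    (abs_nonneg _).trans (Finset.le_sup' (fun i => |S i ω|) (Finset.mem_univ (Classical.arbitrary ι)))
  have hlam2 : σ ^ 2 * lam ^ 2 / 2 = q / 2 := by
    rw [hlam, div_pow, Real.sq_sqrt hq.le]; field_simp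
  have hmgf (i : ι) (t : ℝ) (ht : t ^ 2 = lam ^ 2) :
      ∫ ω, Real.exp (t * S i ω) ∂μ ≤ Real.exp (q / 2) := by
    have := (hS i).mgf_le t
    rwa [Real.coe_toNNReal _ (sq_nonneg _), ht, hlam2] at this
  have hcard : (2 : ℝ) * Fintype.card ι ≤ Real.exp q := by
    rwa [← Real.log_le_iff_le_exp (by positivity)]
  have hmeas : Measurable fun ω => Finset.univ.sup' Finset.univ_nonempty fun i => |S i ω| := by
    have := Finset.measurable_sup' (Finset.univ_nonempty (α := ι))
      (f := fun i ω => |S i ω|) fun i _ => (hSm i).abs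
    convert this using 1
    ext ω
    rw [Finset.sup'_apply]
  refine ⟨hmeas, hI.mono' (hmeas.pow_const q).aestronglyMeasurable (ae_of_all _ fun ω => ?_), ?_⟩
  · rw [Real.norm_of_nonneg (Real.rpow_nonneg (hnn ω) _)]
    exact hpt ω
  calc _ ≤ ∫ ω, ∑ i, C * (Real.exp (lam * S i ω) + Real.exp (-lam * S i ω)) ∂μ :=
        integral_mono_of_nonneg (ae_of_all _ fun ω => Real.rpow_nonneg (hnn ω) _) hI
          (ae_of_all _ hpt)
    _ = ∑ i, C * (∫ ω, Real.exp (lam * S i ω) ∂μ + ∫ ω, Real.exp (-lam * S i ω) ∂μ) := by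
        rw [integral_finsetSum _ fun i _ => hIi i]
        refine Finset.sum_congr rfl fun i _ => ?_
        rw [integral_const_mul, integral_add (hi i lam) (hi i (-lam))]
    _ ≤ ∑ _i : ι, C * (Real.exp (q / 2) + Real.exp (q / 2)) := by
        gcongr with i
        · exact hmgf i lam rfl
        · exact hmgf i (-lam) (neg_sq _)
    _ = C * Real.exp (q / 2) * (2 * Fintype.card ι) := by
        simp only [Finset.sum_const, Finset.card_univ, nsmul_eq_mul]; ring
    _ ≤ C * Real.exp (q / 2) * Real.exp q := by gcongr
    _ = (σ * √q * Real.exp (1 / 2)) ^ q := by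
        have e1 : q / (Real.exp 1 * lam) = σ * √q * Real.exp (-1) := by
          rw [hlam, Real.exp_neg]
          have := Real.mul_self_sqrt hq.le
          have := Real.exp_pos 1
          field_simp
          linarith
        have e2 : Real.exp (1 / 2) = Real.exp (-1) * Real.exp (3 / 2) := by
          rw [← Real.exp_add]; norm_num
        rw [hC, e1, e2, ← mul_assoc, Real.mul_rpow (x := σ * √q * Real.exp (-1)) (by positivity)
          (by positivity), ← Real.exp_mul (3 / 2), mul_assoc, ← Real.exp_add]
        ring_nf
    _ ≤ (2 * σ * √q) ^ q := by
        have h2 : Real.exp (1 / 2) ≤ 2 := by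
          rw [← Real.le_log_iff_exp_le (by norm_num)]
          linarith [Real.log_two_gt_d9]
        refine Real.rpow_le_rpow (by positivity) ?_ hq.le
        nlinarith [mul_pos hσ hq']

variable [IsProbabilityMeasure μ]

lemma integrable_rpow_of_le {G : Ω → ℝ} {p q : ℝ} (hp : 0 < p) (hpq : p ≤ q) (hGm : Measurable G)
    (hG : ∀ ω, 0 ≤ G ω) (hi : Integrable (fun ω => G ω ^ q) μ) :
    Integrable (fun ω => G ω ^ p) μ := by
  refine ((integrable_const (1 : ℝ)).add hi).mono' (hGm.pow_const p).aestronglyMeasurable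
    (ae_of_all _ fun ω => ?_)
  rw [Real.norm_of_nonneg (Real.rpow_nonneg (hG ω) _), Pi.add_apply]
  have h0 : 0 ≤ G ω ^ q := Real.rpow_nonneg (hG ω) _
  rcases le_total (G ω) 1 with h | h
  · linarith [Real.rpow_le_one (hG ω) h hp.le]
  · linarith [Real.rpow_le_rpow_of_exponent_le h hpq]

lemma integrable_rpow_of_bounded {G : Ω → ℝ} {p C : ℝ} (hp : 0 ≤ p) (hGm : Measurable G)
    (hG : ∀ ω, 0 ≤ G ω) (hC : ∀ᵐ ω ∂μ, G ω ≤ C) : Integrable (fun ω => G ω ^ p) μ := by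
  refine Integrable.of_bound (hGm.pow_const p).aestronglyMeasurable (C ^ p) ?_
  filter_upwards [hC] with ω hω
  rw [Real.norm_of_nonneg (Real.rpow_nonneg (hG ω) _)]
  exact Real.rpow_le_rpow (hG ω) hω hp

/-- Monotonicity of the `L^p`-norms with respect to a probability measure. -/
lemma integral_rpow_le_of_le {G : Ω → ℝ} {p q C : ℝ} (hp : 0 < p) (hpq : p ≤ q) (hC : 0 < C)
    (hG : ∀ ω, 0 ≤ G ω) (hi : Integrable (fun ω => G ω ^ q) μ) (h : ∫ ω, G ω ^ q ∂μ ≤ C ^ q) :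
    ∫ ω, G ω ^ p ∂μ ≤ C ^ p := by
  have hq : 0 < q := hp.trans_le hpq
  -- Bernoulli's inequality: the tangent at `1` lies above the concave power `p/q`, here evaluated
  -- at `(x/C)^q`.
  have key (x : ℝ) (hx : 0 ≤ x) : x ^ p ≤ C ^ p * (1 + p / q * (x ^ q / C ^ q - 1)) := by
    have h1 : (x ^ q / C ^ q) ^ (p / q) ≤ 1 + p / q * (x ^ q / C ^ q - 1) := by
      have h2 := rpow_one_add_le_one_add_mul_self (s := x ^ q / C ^ q - 1) (p := p / q)
        (by have : 0 ≤ x ^ q / C ^ q := by positivity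
            linarith) (by positivity) ((div_le_one hq).2 hpq)
      simpa using h2
    have h3 : (x ^ q / C ^ q) ^ (p / q) = x ^ p / C ^ p := by
      rw [← Real.div_rpow hx hC.le, ← Real.rpow_mul (by positivity), mul_div_cancel₀ _ hq.ne',
        Real.div_rpow hx hC.le]
    rw [h3, div_le_iff₀ (by positivity)] at h1
    linarith
  have hCq : 0 < C ^ q := by positivity
  have h1 : Integrable (fun ω => p / q * (G ω ^ q / C ^ q - 1)) μ :=
    ((hi.div_const _).sub (integrable_const _)).const_mul _
  have hI : Integrable (fun ω => C ^ p * (1 + p / q * (G ω ^ q / C ^ q - 1))) μ :=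
    ((integrable_const _).add h1).const_mul _
  calc ∫ ω, G ω ^ p ∂μ ≤ ∫ ω, C ^ p * (1 + p / q * (G ω ^ q / C ^ q - 1)) ∂μ :=
        integral_mono_of_nonneg (ae_of_all _ fun ω => Real.rpow_nonneg (hG ω) _) hI
          (ae_of_all _ fun ω => key _ (hG ω))
    _ = C ^ p * (1 + p / q * ((∫ ω, G ω ^ q ∂μ) / C ^ q - 1)) := by
        rw [integral_const_mul, integral_add (integrable_const _) h1, integral_const_mul,
          integral_sub (hi.div_const _) (integrable_const _), integral_div]
        simp
    _ ≤ C ^ p * 1 := by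
        have h4 : (∫ ω, G ω ^ q ∂μ) / C ^ q ≤ 1 := (div_le_one hCq).2 h
        have h5 : p / q * ((∫ ω, G ω ^ q ∂μ) / C ^ q - 1) ≤ 0 :=
          mul_nonpos_of_nonneg_of_nonpos (by positivity) (by linarith)
        gcongr
        linarith
    _ = C ^ p := mul_one _

/-- Minkowski's inequality for a constant and two nonnegative functions. -/
lemma integral_rpow_le_of_le_add {F f g : Ω → ℝ} {P a α β : ℝ} (hP : 1 ≤ P) (ha : 0 < a)
    (hα : 0 < α) (hβ : 0 < β) (hF : ∀ ω, 0 ≤ F ω) (hf : ∀ ω, 0 ≤ f ω) (hg : ∀ ω, 0 ≤ g ω)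
    (hfi : Integrable (fun ω => f ω ^ P) μ) (hgi : Integrable (fun ω => g ω ^ P) μ)
    (hfα : ∫ ω, f ω ^ P ∂μ ≤ α ^ P) (hgβ : ∫ ω, g ω ^ P ∂μ ≤ β ^ P)
    (h : ∀ᵐ ω ∂μ, F ω ≤ a + f ω + g ω) :
    ∫ ω, F ω ^ P ∂μ ≤ (a + α + β) ^ P := by
  have i1 : Integrable (fun ω => α / (a + α + β) * (f ω ^ P / α ^ P)) μ :=
    (hfi.div_const _).const_mul _
  have i2 : Integrable (fun ω => β / (a + α + β) * (g ω ^ P / β ^ P)) μ :=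
    (hgi.div_const _).const_mul _
  have i3 : Integrable (fun ω => a / (a + α + β) + α / (a + α + β) * (f ω ^ P / α ^ P)) μ :=
    (integrable_const _).add i1
  calc ∫ ω, F ω ^ P ∂μ ≤ ∫ ω, (a + α + β) ^ P * (a / (a + α + β)
        + α / (a + α + β) * (f ω ^ P / α ^ P) + β / (a + α + β) * (g ω ^ P / β ^ P)) ∂μ := by
        refine integral_mono_of_nonneg (ae_of_all _ fun ω => Real.rpow_nonneg (hF ω) _)
          ((i3.add i2).const_mul _) ?_
        filter_upwards [h] with ω hω
        exact (Real.rpow_le_rpow (hF ω) hω (by linarith)).trans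
          (rpow_add_three_le ha hα hβ (hf ω) (hg ω) hP)
    _ = (a + α + β) ^ P * (a / (a + α + β) + α / (a + α + β) * ((∫ ω, f ω ^ P ∂μ) / α ^ P)
        + β / (a + α + β) * ((∫ ω, g ω ^ P ∂μ) / β ^ P)) := by
        rw [integral_const_mul, integral_add i3 i2, integral_add (integrable_const _) i1,
          integral_const_mul, integral_const_mul, integral_div (α ^ P), integral_div (β ^ P)]
        simp
    _ ≤ (a + α + β) ^ P * (a / (a + α + β) + α / (a + α + β) * 1 + β / (a + α + β) * 1) := by
        gcongr
        · exact (div_le_one (by positivity)).2 hfα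
        · exact (div_le_one (by positivity)).2 hgβ
    _ = (a + α + β) ^ P := by field_simp

end Moments

/-! ### Distance from a given parameter to the best of `K` uniform initialisations. -/

section RandomInitialisation

variable {dPar : ℕ}

/-- The maximum distance between the first `n` entries of `θ` and `ϑ`. -/
noncomputable def paramDist (n : ℕ) (ϑ θ : Fin dPar → ℝ) : ℝ :=
  ‖fun j : Fin n => param θ j - param ϑ j‖

lemma continuous_paramDist (n : ℕ) (ϑ : Fin dPar → ℝ) : Continuous (paramDist n ϑ) := by
  unfold paramDist
  exact (continuous_pi fun j => (continuous_param _).sub continuous_const).norm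

lemma paramDist_nonneg (n : ℕ) (ϑ θ : Fin dPar → ℝ) : 0 ≤ paramDist n ϑ θ := norm_nonneg _

lemma abs_param_sub_le_paramDist {n j : ℕ} (hj : j < n) (ϑ θ : Fin dPar → ℝ) :
    |param θ j - param ϑ j| ≤ paramDist n ϑ θ :=
  norm_le_pi_norm (fun j : Fin n => param θ j - param ϑ j) ⟨j, hj⟩

lemma cube_eq_pi (n : ℕ) (r : ℝ) : cube n r = Set.pi Set.univ fun _ => Set.Icc (-r) r := by
  ext; simp [cube, Pi.le_def, forall_and]

lemma measurableSet_cube (n : ℕ) (r : ℝ) : MeasurableSet (cube n r) := by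
  rw [cube_eq_pi]
  exact MeasurableSet.univ_pi fun _ => measurableSet_Icc

lemma volume_cube (n : ℕ) {r : ℝ} (hr : 0 ≤ r) :
    volume (cube n r) = ENNReal.ofReal ((2 * r) ^ n) := by
  rw [cube_eq_pi, volume_pi_pi]
  simp only [Real.volume_Icc, Finset.prod_const, Finset.card_univ, Fintype.card_fin]
  rw [ENNReal.ofReal_pow (by linarith)]
  ring_nf

/-- A uniformly distributed parameter vector is close to a given one with positive probability. -/
lemma ofReal_le_cond_cube_paramDist {n : ℕ} (hn : n ≤ dPar) {c t : ℝ} (hc : 0 < c) (ht : 0 < t)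
    (htc : t ≤ 2 * c) {ϑ : Fin dPar → ℝ} (hϑ : ϑ ∈ cube dPar c) :
    ENNReal.ofReal ((t / (2 * c)) ^ n)
      ≤ ProbabilityTheory.cond volume (cube dPar c) {θ | paramDist n ϑ θ ≤ t} := by
  rw [cond_apply (measurableSet_cube _ _), volume_cube _ hc.le,
    ← ENNReal.ofReal_inv_of_pos (by positivity)]
  -- Only the first `n` coordinates are restricted. There the interval around `ϑ j`, cut to `[-c,
  -- c]`, still has length at least `t`: if both ends are cut it is `2 * c ≥ t`, otherwise one full
  -- side of length `t` remains.
  set a : Fin dPar → ℝ := fun j => if (j : ℕ) < n then max (-c) (ϑ j - t) else -c with ha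
  set b : Fin dPar → ℝ := fun j => if (j : ℕ) < n then min c (ϑ j + t) else c with hb
  have hsub : Set.pi Set.univ (fun j => Set.Icc (a j) (b j))
      ⊆ cube dPar c ∩ {θ | paramDist n ϑ θ ≤ t} := by
    intro θ hθ
    simp only [Set.mem_pi, Set.mem_univ, true_implies, Set.mem_Icc, ha, hb] at hθ
    refine ⟨fun j => ?_, ?_⟩
    · have := hθ j
      split_ifs at this
      · exact ⟨(le_max_left _ _).trans this.1, this.2.trans (min_le_left _ _)⟩
      · exact this
    · refine (pi_norm_le_iff_of_nonneg ht.le).2 fun j => ?_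
      have hj : (j : ℕ) < dPar := j.2.trans_le hn
      have := hθ ⟨j, hj⟩
      simp only [j.2, if_true] at this
      have h1 := (le_max_right _ _).trans this.1
      have h2 := this.2.trans (min_le_right _ _)
      simp only [param, hj, dif_pos, Real.norm_eq_abs]
      exact abs_le.2 ⟨by linarith, by linarith⟩
  have hlen (j : Fin dPar) : (if (j : ℕ) < n then t else 2 * c) ≤ b j - a j := by
    obtain ⟨h1, h2⟩ := hϑ j
    simp only [ha, hb]
    split_ifs
    · rcases max_cases (-c) (ϑ j - t) with ⟨h, -⟩ | ⟨h, -⟩ <;>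
        rcases min_cases c (ϑ j + t) with ⟨h', -⟩ | ⟨h', -⟩ <;> rw [h, h'] <;> linarith
    · linarith
  have hcard : (Finset.univ.filter fun j : Fin dPar => (j : ℕ) < n).card = n := by
    rw [Fin.card_filter_val_lt, min_eq_right hn]
  have hcard' : (Finset.univ.filter fun j : Fin dPar => ¬ (j : ℕ) < n).card = dPar - n := by
    have := Finset.card_filter_add_card_filter_not (s := (Finset.univ : Finset (Fin dPar)))
      fun j : Fin dPar => (j : ℕ) < n
    rw [hcard, Finset.card_univ, Fintype.card_fin] at this
    omega
  calc ENNReal.ofReal ((t / (2 * c)) ^ n)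
      = ENNReal.ofReal ((2 * c) ^ dPar)⁻¹ * ENNReal.ofReal (t ^ n * (2 * c) ^ (dPar - n)) := by
        rw [← ENNReal.ofReal_mul (by positivity)]
        congr 1
        have e : (2 * c) ^ dPar = (2 * c) ^ n * (2 * c) ^ (dPar - n) := by
          rw [← pow_add, Nat.add_sub_of_le hn]
        rw [e, div_pow]
        field_simp
    _ = ENNReal.ofReal ((2 * c) ^ dPar)⁻¹
          * ∏ j : Fin dPar, ENNReal.ofReal (if (j : ℕ) < n then t else 2 * c) := by
        rw [← ENNReal.ofReal_prod_of_nonneg fun j _ => by split_ifs <;> linarith,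
          Finset.prod_ite, Finset.prod_const, Finset.prod_const, hcard, hcard']
    _ ≤ ENNReal.ofReal ((2 * c) ^ dPar)⁻¹
          * volume (Set.pi Set.univ (fun j => Set.Icc (a j) (b j))) := by
        rw [volume_pi_pi]
        simp only [Real.volume_Icc]
        gcongr with j
        exact hlen j
    _ ≤ _ := by gcongr

variable {Ω : Type*} [MeasurableSpace Ω] {μ : Measure Ω}

lemma ae_mem_cube {c : ℝ} {K : ℕ} {Θ : ℕ → Ω → Fin dPar → ℝ}
    (hΘ : ∀ k, Measurable (Θ k)) (hiid : IsIIDOn (Set.Icc 1 K) Θ μ)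
    (hunif : pdf.IsUniform (Θ 1) (cube dPar c) μ volume) {k : ℕ} (hk : k ∈ Set.Icc 1 K) :
    ∀ᵐ ω ∂μ, Θ k ω ∈ cube dPar c := by
  have hmap : μ.map (Θ k) = ProbabilityTheory.cond volume (cube dPar c) := by
    rw [← hunif, (hiid.2.2 k hk 1 ⟨le_rfl, hk.1.trans hk.2⟩).map_eq]
  have : ∀ᵐ θ ∂(μ.map (Θ k)), θ ∈ cube dPar c := by
    rw [hmap]
    exact ae_cond_mem (measurableSet_cube _ _)
  exact ae_of_ae_map (hΘ k).aemeasurable this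

lemma measurable_inf_paramDist (n : ℕ) (ϑ : Fin dPar → ℝ) {K : ℕ}
    (hK : (Finset.Icc 1 K).Nonempty) {Θ : ℕ → Ω → Fin dPar → ℝ} (hΘ : ∀ k, Measurable (Θ k)) :
    Measurable fun ω => (Finset.Icc 1 K).inf' hK fun k => paramDist n ϑ (Θ k ω) := by
  have h : Continuous fun z : ℕ → Fin dPar → ℝ =>
      (Finset.Icc 1 K).inf' hK fun k => paramDist n ϑ (z k) :=
    Continuous.finset_inf'_apply hK fun k _ => (continuous_paramDist n ϑ).comp (continuous_apply k)
  exact h.measurable.comp (measurable_pi_lambda _ hΘ)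

variable [IsProbabilityMeasure μ]

/-- The tail of the distance of the best of `K` uniform initialisations to `ϑ`. -/
lemma measure_lt_inf_paramDist_le {n : ℕ} (hn : n ≤ dPar) {c : ℝ} {K : ℕ} (hc : 0 < c)
    (hK : (Finset.Icc 1 K).Nonempty) {Θ : ℕ → Ω → Fin dPar → ℝ} (hΘ : ∀ k, Measurable (Θ k))
    (hiid : IsIIDOn (Set.Icc 1 K) Θ μ)
    (hunif : pdf.IsUniform (Θ 1) (cube dPar c) μ volume)
    {ϑ : Fin dPar → ℝ} (hϑ : ϑ ∈ cube dPar c) {t : ℝ} (ht : 0 < t) :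
    μ {ω | t < (Finset.Icc 1 K).inf' hK fun k => paramDist n ϑ (Θ k ω)}
      ≤ ENNReal.ofReal (Real.exp (-(K / (2 * c) ^ n) * t ^ n)) := by
  have hK1 : 1 ≤ K := Finset.nonempty_Icc.1 hK
  -- Beyond the diameter `2 * c` the event is null, since both vectors lie in the cube almost
  -- surely; below it, `(1 - x)^K ≤ exp(-K x)`.
  rcases lt_or_ge (2 * c) t with htc | htc
  · have h0 : μ {ω | t < (Finset.Icc 1 K).inf' hK fun k => paramDist n ϑ (Θ k ω)} = 0 := by
      refine measure_mono_null (t := {ω | ¬ Θ 1 ω ∈ cube dPar c}) (fun ω hω hmem => ?_)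
        (ae_iff.1 (ae_mem_cube hΘ hiid hunif ⟨le_rfl, hK1⟩))
      have h1 : t < paramDist n ϑ (Θ 1 ω) :=
        (Finset.lt_inf'_iff (f := fun k => paramDist n ϑ (Θ k ω)) hK).1 hω 1 (Finset.mem_Icc.2 ⟨le_rfl, hK1⟩)
      have h2 : paramDist n ϑ (Θ 1 ω) ≤ 2 * c := by
        refine (pi_norm_le_iff_of_nonneg (by positivity)).2 fun j => ?_
        have a1 := abs_le.1 (abs_param_le_of_mem_cube hc.le hmem j)
        have a2 := abs_le.1 (abs_param_le_of_mem_cube hc.le hϑ j)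
        exact abs_le.2 ⟨by linarith, by linarith⟩
      linarith
    rw [h0]
    exact zero_le
  · set U : Set (Fin dPar → ℝ) := {θ | t < paramDist n ϑ θ} with hU
    have hUm : MeasurableSet U :=
      measurableSet_lt measurable_const (continuous_paramDist n ϑ).measurable
    set x := (t / (2 * c)) ^ n with hx
    have hx0 : 0 ≤ x := by positivity
    have hx1 : x ≤ 1 := pow_le_one₀ (by positivity) ((div_le_one (by positivity)).2 htc)
    have hprob (k : Set.Icc 1 K) : μ (Θ k ⁻¹' U) ≤ ENNReal.ofReal (1 - x) := by
      have hmap : μ.map (Θ k) = ProbabilityTheory.cond volume (cube dPar c) := by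
        rw [← hunif, (hiid.2.2 k k.2 1 ⟨le_rfl, hK1⟩).map_eq]
      have : IsProbabilityMeasure (ProbabilityTheory.cond volume (cube dPar c)) := by
        rw [← hmap]; exact Measure.isProbabilityMeasure_map (hΘ k).aemeasurable
      rw [← Measure.map_apply (hΘ k) hUm, hmap]
      have hcompl : U = {θ | paramDist n ϑ θ ≤ t}ᶜ := by ext; simp [hU]
      rw [hcompl, prob_compl_eq_one_sub
        (measurableSet_le (continuous_paramDist n ϑ).measurable measurable_const),
        ENNReal.ofReal_sub _ hx0, ENNReal.ofReal_one]
      gcongr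
      exact ofReal_le_cond_cube_paramDist hn hc ht htc hϑ
    have hset : {ω | t < (Finset.Icc 1 K).inf' hK fun k => paramDist n ϑ (Θ k ω)}
        = ⋂ k ∈ (Finset.univ : Finset (Set.Icc 1 K)), Θ k ⁻¹' U := by
      ext ω
      simp [hU, Finset.lt_inf'_iff]
    rw [hset, hiid.2.1.measure_inter_preimage_eq_mul Finset.univ (sets := fun _ => U)
      fun _ _ => hUm]
    calc ∏ k : Set.Icc 1 K, μ (Θ k ⁻¹' U) ≤ ∏ _k : Set.Icc 1 K, ENNReal.ofReal (1 - x) :=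
          Finset.prod_le_prod' fun k _ => hprob k
      _ = ENNReal.ofReal ((1 - x) ^ K) := by
          rw [ENNReal.ofReal_pow (by linarith)]
          simp
      _ ≤ ENNReal.ofReal (Real.exp (-x) ^ K) := by
          gcongr
          have := Real.add_one_le_exp (-x)
          linarith
      _ = _ := by
          rw [← Real.exp_nat_mul, hx, div_pow]
          congr 2
          ring

/-- The tail rate is `κ = K/(2c)^n`, so `κ^(-1/n) = 2c * K^(-1/n)`. -/
lemma integral_inf_paramDist_rpow_le {n : ℕ} (hn1 : 1 ≤ n) (hn : n ≤ dPar) {c : ℝ} {K : ℕ}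
    (hc : 0 < c) (hK : (Finset.Icc 1 K).Nonempty) {Θ : ℕ → Ω → Fin dPar → ℝ}
    (hΘ : ∀ k, Measurable (Θ k)) (hiid : IsIIDOn (Set.Icc 1 K) Θ μ)
    (hunif : pdf.IsUniform (Θ 1) (cube dPar c) μ volume)
    {ϑ : Fin dPar → ℝ} (hϑ : ϑ ∈ cube dPar c) {P : ℝ} (hP : 1 ≤ P) :
    ∫ ω, ((Finset.Icc 1 K).inf' hK fun k => paramDist n ϑ (Θ k ω)) ^ P ∂μ
      ≤ (P * (2 * c) * (K : ℝ) ^ (-(1 / (n : ℝ)))) ^ P := by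
  have hK1 : 1 ≤ K := Finset.nonempty_Icc.1 hK
  have hK0 : (0 : ℝ) < K := by exact_mod_cast hK1
  have hn0 : (n : ℝ) ≠ 0 := by positivity
  have h := integral_rpow_le_of_tail (μ := μ)
    (Z := fun ω => (Finset.Icc 1 K).inf' hK fun k => paramDist n ϑ (Θ k ω))
    (fun ω => (Finset.le_inf'_iff hK _).2 fun k _ => paramDist_nonneg _ _ _)
    (measurable_inf_paramDist n ϑ hK hΘ) hn1
    (κ := K / (2 * c) ^ n) (by positivity) hP
    (fun t ht => measure_lt_inf_paramDist_le hn hc hK hΘ hiid hunif hϑ ht)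
  refine h.trans_eq ?_
  congr 1
  rw [Real.div_rpow hK0.le (by positivity), ← Real.rpow_natCast, ← Real.rpow_mul (by positivity),
    mul_neg, mul_one_div_cancel hn0, Real.rpow_neg_one]
  field_simp

end RandomInitialisation

/-! ### Concentration of empirical means and the bias-variance identity. -/

section Generalisation

variable {Ω : Type*} [MeasurableSpace Ω] {μ : Measure Ω} [IsProbabilityMeasure μ]

/-- Hoeffding's lemma for the deviation of an empirical mean of i.i.d. random variables. -/
lemma hasSubgaussianMGF_empirical_mean {S : Type*} [MeasurableSpace S] {M : ℕ} (hM : 1 ≤ M)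
    {Z : ℕ → Ω → S} (hZ : IsIIDOn (Set.Icc 1 M) Z μ) {g : S → ℝ} (hg : Measurable g) {w : ℝ}
    (hw : ∀ z, g z ∈ Set.Icc 0 w) :
    HasSubgaussianMGF (fun ω => 1 / (M : ℝ) * ∑ j ∈ Finset.Icc 1 M, g (Z j ω) - ∫ ω, g (Z 1 ω) ∂μ)
      (Real.toNNReal ((w / (2 * √M)) ^ 2)) μ := by
  have hM0 : (0 : ℝ) < M := by exact_mod_cast hM
  have h1 (j : Set.Icc 1 M) : HasSubgaussianMGF (fun ω => g (Z j ω) - ∫ ω, g (Z 1 ω) ∂μ)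
      ((‖w - 0‖₊ / 2) ^ 2) μ := by
    have hm : Measurable fun ω => g (Z j ω) := hg.comp (hZ.1 j j.2)
    have := hasSubgaussianMGF_of_mem_Icc (μ := μ) (a := 0) (b := w) hm.aemeasurable
      (ae_of_all _ fun ω => hw _)
    rwa [show ∫ ω, g (Z j ω) ∂μ = ∫ ω, g (Z 1 ω) ∂μ from
      ((hZ.2.2 j j.2 1 ⟨le_rfl, hM⟩).comp hg).integral_eq] at this
  have hind : iIndepFun (fun (j : Set.Icc 1 M) ω => g (Z j ω) - ∫ ω, g (Z 1 ω) ∂μ) μ :=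
    hZ.2.1.comp (fun _ z => g z - ∫ ω, g (Z 1 ω) ∂μ) fun _ => hg.sub_const _
  have h2 := (HasSubgaussianMGF.sum_of_iIndepFun hind (s := Finset.univ) fun j _ => h1 j).const_mul
    (1 / (M : ℝ))
  convert h2 using 1
  · ext ω
    rw [Finset.sum_sub_distrib, mul_sub]
    congr 1
    · congr 1
      exact Finset.sum_subtype (Finset.Icc 1 M) (by simp) fun j => g (Z j ω)
    · simp; field_simp
  -- Each of the `M` summands has variance proxy `(w/2)²`; scaling by `1/M` gives `w²/(4M)`.
  · ext
    rw [Real.coe_toNNReal _ (sq_nonneg _)]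
    simp only [sub_zero, Finset.sum_const, Finset.card_univ, nsmul_eq_mul]
    change _ = (1 / (M : ℝ)) ^ 2 * ((Fintype.card (Set.Icc 1 M) : NNReal) * (‖w‖₊ / 2) ^ 2 : NNReal)
    have hcard : Fintype.card (Set.Icc 1 M) = M := by simp
    rw [hcard]
    push_cast
    rw [div_pow, mul_pow, Real.sq_sqrt hM0.le, div_pow ‖w‖, Real.norm_eq_abs, sq_abs]
    field_simp

/-- The bias-variance decomposition of the mean squared error. -/
lemma integral_sq_sub_eq {S : Type*} [MeasurableSpace S] {X : Ω → S} (hX : Measurable X)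
    {Y : Ω → ℝ} (hY : Measurable Y) {e f : S → ℝ} (he : Measurable e) (hf : Measurable f)
    {u v : ℝ} (hYb : ∀ ω, Y ω ∈ Set.Icc u v) (heb : ∀ x, e x ∈ Set.Icc u v)
    (hfb : ∀ x, f x ∈ Set.Icc u v)
    (hcond : (fun ω => e (X ω)) =ᵐ[μ] μ[Y | MeasurableSpace.comap X inferInstance]) :
    ∫ ω, (f (X ω) - Y ω) ^ 2 ∂μ
      = ∫ x, (f x - e x) ^ 2 ∂(μ.map X) + ∫ ω, (e (X ω) - Y ω) ^ 2 ∂μ := by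
  have hXm : Measurable[MeasurableSpace.comap X inferInstance] X := comap_measurable X
  have hle : MeasurableSpace.comap X inferInstance ≤ (inferInstance : MeasurableSpace Ω) :=
    hX.comap_le
  have hdiff {a b : ℝ} (ha : a ∈ Set.Icc u v) (hb : b ∈ Set.Icc u v) : |a - b| ≤ v - u :=
    abs_le.2 ⟨by linarith [ha.1, hb.2], by linarith [ha.2, hb.1]⟩
  have hYi : Integrable Y μ := Integrable.of_mem_Icc u v hY.aemeasurable (ae_of_all _ hYb)
  set h : Ω → ℝ := fun ω => f (X ω) - e (X ω) with hh
  have hhm : Measurable[MeasurableSpace.comap X inferInstance] h :=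
    (hf.comp hXm).sub (he.comp hXm)
  have hhm' : Measurable h := (hf.comp hX).sub (he.comp hX)
  have hhb (ω : Ω) : ‖h ω‖ ≤ v - u := hdiff (hfb _) (heb _)
  have hhY : Integrable (h * Y) μ :=
    hYi.bdd_mul hhm'.aestronglyMeasurable (ae_of_all _ hhb)
  have hei : Integrable (fun ω => e (X ω)) μ :=
    Integrable.of_mem_Icc u v (he.comp hX).aemeasurable (ae_of_all _ fun ω => heb _)
  have hhe : Integrable (fun ω => h ω * e (X ω)) μ :=
    hei.bdd_mul hhm'.aestronglyMeasurable (ae_of_all _ hhb)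
  have hhY' : Integrable (fun ω => h ω * Y ω) μ := hhY
  -- The cross term vanishes: `h` is a function of `X`, so it can be pulled out of the conditional
  -- expectation of `Y`.
  have key : ∫ ω, h ω * Y ω ∂μ = ∫ ω, h ω * e (X ω) ∂μ := by
    have h1 := condExp_mul_of_stronglyMeasurable_left hhm.stronglyMeasurable hhY hYi
    calc ∫ ω, h ω * Y ω ∂μ = ∫ ω, (μ[h * Y | MeasurableSpace.comap X inferInstance]) ω ∂μ :=
          (integral_condExp hle).symm
      _ = ∫ ω, h ω * e (X ω) ∂μ := by
          refine integral_congr_ae ?_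
          filter_upwards [h1, hcond] with ω a1 a2
          rw [a1, Pi.mul_apply, ← a2]
  have hi1 : Integrable (fun ω => (f (X ω) - e (X ω)) ^ 2) μ := by
    simp only [sq]
    exact (Integrable.of_bound hhm'.aestronglyMeasurable _ (ae_of_all _ hhb)).bdd_mul
      hhm'.aestronglyMeasurable (ae_of_all _ hhb)
  have hi2 : Integrable (fun ω => (e (X ω) - Y ω) ^ 2) μ := by
    have hm : Measurable fun ω => e (X ω) - Y ω := (he.comp hX).sub hY
    simp only [sq]
    exact (hei.sub hYi).bdd_mul hm.aestronglyMeasurable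
      (ae_of_all _ fun ω => hdiff (heb _) (hYb ω))
  have hmap : ∫ x, (f x - e x) ^ 2 ∂(μ.map X) = ∫ ω, (f (X ω) - e (X ω)) ^ 2 ∂μ :=
    integral_map hX.aemeasurable ((hf.sub he).pow_const 2).aestronglyMeasurable
  have hexp : ∀ ω, (f (X ω) - Y ω) ^ 2 = (f (X ω) - e (X ω)) ^ 2 + (e (X ω) - Y ω) ^ 2
      + (2 * (h ω * e (X ω)) - 2 * (h ω * Y ω)) := fun ω => by simp only [hh]; ring
  simp_rw [hexp]
  have hi3 : Integrable (fun ω => 2 * (h ω * e (X ω)) - 2 * (h ω * Y ω)) μ :=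
    (hhe.const_mul 2).sub (hhY'.const_mul 2)
  have hi4 : Integrable (fun ω => (f (X ω) - e (X ω)) ^ 2 + (e (X ω) - Y ω) ^ 2) μ := hi1.add hi2
  rw [integral_add hi4 hi3, integral_add hi1 hi2,
    integral_sub (hhe.const_mul 2) (hhY'.const_mul 2), integral_const_mul, integral_const_mul, hmap]
  rw [key]
  ring

end Generalisation

/-! ### Finite grids in a cube of parameters. -/

section Net

lemma exists_center {B x : ℝ} {m : ℕ} (hm : 1 ≤ m) (hB : 0 < B) (hx : x ∈ Set.Icc (-B) B) :
    ∃ k : Fin m, |x - (-B + (2 * (k : ℕ) + 1) * (B / m))| ≤ B / m := by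
  have hm0 : (0 : ℝ) < m := by exact_mod_cast hm
  have hBm : 0 < B / m := by positivity
  obtain ⟨k, hk, h1, h2⟩ : ∃ k < m, 2 * k * (B / m) ≤ x + B ∧ x + B ≤ 2 * (k + 1) * (B / m) := by
    have hmB : m * (B / m) = B := by field_simp
    -- At `x = B` the floor would be `m`, which is out of range, so the last cell is taken.
    rcases eq_or_lt_of_le hx.2 with h | h
    · refine ⟨m - 1, by omega, ?_, ?_⟩ <;> rw [Nat.cast_sub hm] <;> push_cast <;> nlinarith
    · have h0 : 0 ≤ (x + B) / (2 * (B / m)) := div_nonneg (by linarith [hx.1]) (by positivity)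
      have h3 := Nat.floor_le h0
      have h4 := (Nat.lt_floor_add_one ((x + B) / (2 * (B / m)))).le
      rw [le_div_iff₀ (by positivity)] at h3
      rw [div_le_iff₀ (by positivity)] at h4
      refine ⟨⌊(x + B) / (2 * (B / m))⌋₊, (Nat.floor_lt h0).2 ?_, by linarith, by linarith⟩
      rw [div_lt_iff₀ (by positivity)]
      nlinarith
  exact ⟨⟨k, hk⟩, abs_le.2 ⟨by simp only; linarith, by simp only; linarith⟩⟩

/-- A product grid in the first `n` coordinates, the others being `0`; its cardinality `m^n` does
not involve `dPar`. -/
lemma exists_net (n dPar : ℕ) {B : ℝ} (hB : 0 < B) {m : ℕ} (hm : 1 ≤ m) :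
    ∃ net : (Fin n → Fin m) → Fin dPar → ℝ, (∀ g, net g ∈ cube dPar B) ∧
      ∀ θ ∈ cube dPar B, ∃ g, ∀ j < n, |param θ j - param (net g) j| ≤ B / m := by
  have hm0 : (0 : ℝ) < m := by exact_mod_cast hm
  refine ⟨fun g i => if h : (i : ℕ) < n then -B + (2 * (g ⟨i, h⟩ : ℕ) + 1) * (B / m) else 0,
    fun g i => ?_, fun θ hθ => ?_⟩
  · simp only
    split_ifs with h
    · have h1 : ((g ⟨i, h⟩ : ℕ) : ℝ) + 1 ≤ m := by exact_mod_cast (g ⟨i, h⟩).2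
      have hBm : 0 < B / m := by positivity
      have hmB : m * (B / m) = B := by field_simp
      have h2 : ((g ⟨i, h⟩ : ℕ) + 1) * (B / m) ≤ B := by nlinarith
      have h3 : 0 ≤ ((g ⟨i, h⟩ : ℕ) : ℝ) * (B / m) := by positivity
      exact ⟨by linarith, by linarith⟩
    · exact ⟨by linarith, hB.le⟩
  · have hp (j : Fin n) : param θ j ∈ Set.Icc (-B) B :=
      abs_le.1 (abs_param_le_of_mem_cube hB.le hθ j)
    choose g hg using fun j : Fin n => exists_center hm hB (hp j)
    refine ⟨g, fun j hj => ?_⟩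
    by_cases hjd : j < dPar
    · have := hg ⟨j, hj⟩
      simpa [param, hjd, hj] using this
    · simp only [param, hjd, dif_neg, not_false_eq_true, sub_zero, abs_zero]
      positivity

end Net

/-! ### Empirical and true risk, and the error decomposition for a parametric family. -/

section Risk

lemma abs_sub_le_of_mem_Icc {u v a b : ℝ} (ha : a ∈ Set.Icc u v) (hb : b ∈ Set.Icc u v) :
    |a - b| ≤ v - u :=
  abs_le.2 ⟨by linarith [ha.1, hb.2], by linarith [ha.2, hb.1]⟩

lemma sq_sub_mem_Icc {u v a b : ℝ} (ha : a ∈ Set.Icc u v) (hb : b ∈ Set.Icc u v) :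
    (a - b) ^ 2 ∈ Set.Icc 0 ((v - u) ^ 2) :=
  ⟨sq_nonneg _, sq_le_sq' (abs_le.1 (abs_sub_le_of_mem_Icc ha hb)).1
    (abs_le.1 (abs_sub_le_of_mem_Icc ha hb)).2⟩

lemma abs_sq_sub_sq_le {u v a b y : ℝ} (ha : a ∈ Set.Icc u v) (hb : b ∈ Set.Icc u v)
    (hy : y ∈ Set.Icc u v) : |(a - y) ^ 2 - (b - y) ^ 2| ≤ 2 * (v - u) * |a - b| := by
  rw [show (a - y) ^ 2 - (b - y) ^ 2 = ((a - y) + (b - y)) * (a - b) by ring, abs_mul]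
  gcongr
  have h1 := abs_sub_le_of_mem_Icc ha hy
  have h2 := abs_sub_le_of_mem_Icc hb hy
  linarith [abs_add_le (a - y) (b - y)]

variable {Ω S : Type*} {u v : ℝ} {dPar n M : ℕ}

/-- The empirical mean squared error of `f`. -/
noncomputable def empRisk (M : ℕ) (X : ℕ → Ω → S) (Y : ℕ → Ω → Set.Icc u v) (f : S → ℝ)
    (ω : Ω) : ℝ :=
  1 / (M : ℝ) * ∑ j ∈ Finset.Icc 1 M, (f (X j ω) - Y j ω) ^ 2

lemma abs_empRisk_sub_le (hM : 1 ≤ M) (X : ℕ → Ω → S) (Y : ℕ → Ω → Set.Icc u v)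
    {f g : S → ℝ} (hf : ∀ x, f x ∈ Set.Icc u v) (hg : ∀ x, g x ∈ Set.Icc u v) {δ : ℝ}
    (huv : u ≤ v) (hfg : ∀ x, |f x - g x| ≤ δ) (ω : Ω) :
    |empRisk M X Y f ω - empRisk M X Y g ω| ≤ 2 * (v - u) * δ := by
  have hM0 : (0 : ℝ) < M := by exact_mod_cast hM
  have huv' : 0 ≤ v - u := sub_nonneg.2 huv
  unfold empRisk
  rw [← mul_sub, ← Finset.sum_sub_distrib, abs_mul, abs_of_pos (by positivity : 0 < 1 / (M : ℝ))]
  calc _ ≤ 1 / (M : ℝ) * ∑ _j ∈ Finset.Icc 1 M, 2 * (v - u) * δ := by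
        gcongr
        refine (Finset.abs_sum_le_sum_abs _ _).trans (Finset.sum_le_sum fun j _ => ?_)
        refine (abs_sq_sub_sq_le (hf _) (hg _) (Y j ω).2).trans ?_
        gcongr
        exact hfg _
    _ = 2 * (v - u) * δ := by
        simp
        field_simp

variable [MeasurableSpace Ω] [MeasurableSpace S] {μ : Measure Ω} [IsProbabilityMeasure μ]

lemma abs_integral_sq_sub_le {X : Ω → S} {Y : Ω → Set.Icc u v} (hX : Measurable X)
    (hY : Measurable Y) {f g : S → ℝ} (hfm : Measurable f) (hgm : Measurable g)
    (hf : ∀ x, f x ∈ Set.Icc u v) (hg : ∀ x, g x ∈ Set.Icc u v) {δ : ℝ}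
    (huv : u ≤ v) (hfg : ∀ x, |f x - g x| ≤ δ) :
    |∫ ω, (f (X ω) - Y ω) ^ 2 ∂μ - ∫ ω, (g (X ω) - Y ω) ^ 2 ∂μ| ≤ 2 * (v - u) * δ := by
  have huv' : 0 ≤ v - u := sub_nonneg.2 huv
  have hi {h : S → ℝ} (hm : Measurable h) (hb : ∀ x, h x ∈ Set.Icc u v) :
      Integrable (fun ω => (h (X ω) - Y ω) ^ 2) μ :=
    Integrable.of_mem_Icc 0 ((v - u) ^ 2)
      (((hm.comp hX).sub (measurable_subtype_coe.comp hY)).pow_const 2).aemeasurable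
      (ae_of_all _ fun ω => sq_sub_mem_Icc (hb _) (Y ω).2)
  rw [← integral_sub (hi hfm hf) (hi hgm hg)]
  have key (ω : Ω) : ‖(f (X ω) - Y ω) ^ 2 - (g (X ω) - Y ω) ^ 2‖ ≤ 2 * (v - u) * δ := by
    refine (abs_sq_sub_sq_le (hf _) (hg _) (Y ω).2).trans ?_
    gcongr
    exact hfg _
  calc _ ≤ 2 * (v - u) * δ * μ.real Set.univ := norm_integral_le_of_norm_le_const (ae_of_all _ key)
    _ = 2 * (v - u) * δ := by simp

/-- Uniform control of the generalisation error over a cube of parameters. -/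
lemma exists_uniform_deviation (hM : 1 ≤ M) {X : ℕ → Ω → S} {Y : ℕ → Ω → Set.Icc u v}
    (hXY : IsIIDOn (Set.Icc 1 M) (fun j ω => (X j ω, Y j ω)) μ) (huv : u < v)
    {NN : (Fin dPar → ℝ) → S → ℝ} (hNm : ∀ θ, Measurable (NN θ))
    (hN : ∀ θ x, NN θ x ∈ Set.Icc u v) {B Λ : ℝ} (hB : 0 < B)
    (hLip : ∀ θ ∈ cube dPar B, ∀ ϑ ∈ cube dPar B, ∀ ε, 0 ≤ ε →
      (∀ j < n, |param θ j - param ϑ j| ≤ ε) → ∀ x, |NN θ x - NN ϑ x| ≤ Λ * ε)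
    {m : ℕ} (hm : 1 ≤ m) {q : ℝ} (hq : 0 < q) (hqm : Real.log (2 * (m : ℝ) ^ n) ≤ q) :
    ∃ G : Ω → ℝ, Measurable G ∧ (∀ ω, 0 ≤ G ω) ∧ Integrable (fun ω => G ω ^ q) μ ∧
      ∫ ω, G ω ^ q ∂μ ≤ (2 * ((v - u) ^ 2 / (2 * √M)) * √q) ^ q ∧
      ∀ ω, ∀ θ ∈ cube dPar B, |empRisk M X Y (NN θ) ω - ∫ ω, (NN θ (X 1 ω) - Y 1 ω) ^ 2 ∂μ|
        ≤ G ω + 4 * (v - u) * (Λ * (B / m)) := by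
  have hM0 : (0 : ℝ) < M := by exact_mod_cast hM
  have huv' : 0 < v - u := sub_pos.2 huv
  have hm0 : (0 : ℝ) < m := by exact_mod_cast hm
  have : Nonempty (Fin m) := ⟨⟨0, hm⟩⟩
  have h11 : (1 : ℕ) ∈ Set.Icc 1 M := ⟨le_rfl, hM⟩
  have hXm {j : ℕ} (hj : j ∈ Set.Icc 1 M) : Measurable (X j) := measurable_fst.comp (hXY.1 j hj)
  have hYm {j : ℕ} (hj : j ∈ Set.Icc 1 M) : Measurable (Y j) := measurable_snd.comp (hXY.1 j hj)
  obtain ⟨net, hnet, hcov⟩ := exists_net n dPar hB hm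
  set dev : (Fin dPar → ℝ) → Ω → ℝ := fun θ ω =>
    empRisk M X Y (NN θ) ω - ∫ ω, (NN θ (X 1 ω) - Y 1 ω) ^ 2 ∂μ with hdev
  have hdm (θ : Fin dPar → ℝ) : Measurable (dev θ) := by
    refine Measurable.sub_const (Measurable.const_mul ?_ _) _
    refine Finset.measurable_fun_sum _ fun j hj => ?_
    have hj' : j ∈ Set.Icc 1 M := by simpa using hj
    exact (((hNm θ).comp (hXm hj')).sub (measurable_subtype_coe.comp (hYm hj'))).pow_const 2
  have hsub (θ : Fin dPar → ℝ) : HasSubgaussianMGF (dev θ)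
      (Real.toNNReal (((v - u) ^ 2 / (2 * √M)) ^ 2)) μ :=
    hasSubgaussianMGF_empirical_mean hM hXY (g := fun z => (NN θ z.1 - (z.2 : ℝ)) ^ 2)
      ((((hNm θ).comp measurable_fst).sub (measurable_subtype_coe.comp measurable_snd)).pow_const 2)
      fun z => sq_sub_mem_Icc (hN _ _) z.2.2
  obtain ⟨h1, h2, h3⟩ := integral_sup_rpow_le (ι := Fin n → Fin m) (S := fun g => dev (net g))
    (σ := (v - u) ^ 2 / (2 * √M)) (q := q) (by positivity) hq (by simpa using hqm)
    (fun g => hdm _) (fun g => hsub _)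
  refine ⟨_, h1, fun ω => ?_, h2, h3, fun ω θ hθ => ?_⟩
  · exact (abs_nonneg _).trans (Finset.le_sup' (fun g => |dev (net g) ω|)
      (Finset.mem_univ (Classical.arbitrary _)))
  · obtain ⟨g, hg⟩ := hcov θ hθ
    have hl := hLip θ hθ (net g) (hnet g) (B / m) (by positivity) hg
    have e1 := abs_empRisk_sub_le hM X Y (hN θ) (hN (net g)) huv.le hl ω
    have e2 := abs_integral_sq_sub_le (μ := μ) (hXm h11) (hYm h11) (hNm θ) (hNm (net g)) (hN θ)
      (hN (net g)) huv.le hl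
    have e3 : |dev (net g) ω| ≤ Finset.univ.sup' Finset.univ_nonempty fun g => |dev (net g) ω| :=
      Finset.le_sup' (fun g => |dev (net g) ω|) (Finset.mem_univ g)
    -- Moving to the grid point changes the empirical and the true risk by at most `2 (v-u) Λ B/m`
    -- each.
    have e4 : |dev θ ω| ≤ |dev (net g) ω| + 4 * (v - u) * (Λ * (B / m)) := by
      simp only [hdev]
      rw [abs_le] at e1 e2
      have a1 := neg_abs_le (dev (net g) ω)
      have a2 := le_abs_self (dev (net g) ω)
      simp only [hdev] at a1 a2
      exact abs_le.2 ⟨by linarith, by linarith⟩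
    exact e4.trans (by gcongr)

/-- The error analysis for a parametric family: approximation, generalisation and optimisation
by random initialisation. -/
lemma integral_error_rpow_le (hM : 1 ≤ M) {X : ℕ → Ω → S} {Y : ℕ → Ω → Set.Icc u v}
    (hXY : IsIIDOn (Set.Icc 1 M) (fun j ω => (X j ω, Y j ω)) μ) (huv : u < v)
    {NN : (Fin dPar → ℝ) → S → ℝ} (hNN : Measurable fun z : (Fin dPar → ℝ) × S => NN z.1 z.2)
    (hN : ∀ θ x, NN θ x ∈ Set.Icc u v) {E : S → ℝ} (hE : Measurable E)
    (hEb : ∀ x, E x ∈ Set.Icc u v)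
    (hcond : (fun ω => E (X 1 ω)) =ᵐ[μ]
      μ[fun ω => (Y 1 ω : ℝ) | MeasurableSpace.comap (X 1) inferInstance])
    {c B Λc ΛB : ℝ} (hc : 0 < c) (hcB : c ≤ B) (hΛc : 0 < Λc) (hΛB : 0 < ΛB)
    (hLipc : ∀ θ ∈ cube dPar c, ∀ ϑ ∈ cube dPar c, ∀ ε, 0 ≤ ε →
      (∀ j < n, |param θ j - param ϑ j| ≤ ε) → ∀ x, |NN θ x - NN ϑ x| ≤ Λc * ε)
    (hLipB : ∀ θ ∈ cube dPar B, ∀ ϑ ∈ cube dPar B, ∀ ε, 0 ≤ ε →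
      (∀ j < n, |param θ j - param ϑ j| ≤ ε) → ∀ x, |NN θ x - NN ϑ x| ≤ ΛB * ε)
    (hn1 : 1 ≤ n) (hn : n ≤ dPar) {K : ℕ} (hK : 1 ≤ K)
    {Θ : ℕ → Ω → Fin dPar → ℝ} (hΘ : ∀ k, Measurable (Θ k))
    (hiid : IsIIDOn (Set.Icc 1 K) Θ μ) (hunif : pdf.IsUniform (Θ 1) (cube dPar c) μ volume)
    {T : Ω → Fin dPar → ℝ} (hT : Measurable T) (hTB : ∀ ω, T ω ∈ cube dPar B)
    (hmin : ∀ ω, ∀ k ∈ Finset.Icc 1 K,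
      empRisk M X Y (NN (T ω)) ω ≤ empRisk M X Y (NN (Θ k ω)) ω)
    {m : ℕ} (hm : 1 ≤ m) {p P q : ℝ} (hp : 0 < p) (hpP : p ≤ P) (hP : 1 ≤ P) (hPq : P ≤ q)
    (hqm : Real.log (2 * (m : ℝ) ^ n) ≤ q)
    {ϑ : Fin dPar → ℝ} (hϑ : ϑ ∈ cube dPar c) {a : ℝ} (ha : 0 < a)
    (hϑa : ∀ x, (NN ϑ x - E x) ^ 2 ≤ a) :
    ∫ ω, (∫ x, (NN (T ω) x - E x) ^ 2 ∂(μ.map (X 1))) ^ p ∂μ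
      ≤ (a + 2 * (v - u) * Λc * (P * (2 * c) * (K : ℝ) ^ (-(1 / (n : ℝ))))
        + (8 * (v - u) * (ΛB * (B / m)) + 2 * (2 * ((v - u) ^ 2 / (2 * √M)) * √q))) ^ p := by
  have hB : 0 < B := hc.trans_le hcB
  have hM0 : (0 : ℝ) < M := by exact_mod_cast hM
  have hm0 : (0 : ℝ) < m := by exact_mod_cast hm
  have hK0 : (0 : ℝ) < K := by exact_mod_cast hK
  have huv' : 0 < v - u := sub_pos.2 huv
  have hP0 : 0 < P := by linarith
  have hq : 0 < q := by linarith
  have h11 : (1 : ℕ) ∈ Set.Icc 1 M := ⟨le_rfl, hM⟩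
  have hX1 : Measurable (X 1) := measurable_fst.comp (hXY.1 1 h11)
  have hY1 : Measurable (Y 1) := measurable_snd.comp (hXY.1 1 h11)
  have : IsProbabilityMeasure (μ.map (X 1)) := Measure.isProbabilityMeasure_map hX1.aemeasurable
  have hNm (θ : Fin dPar → ℝ) : Measurable (NN θ) := hNN.comp measurable_prodMk_left
  obtain ⟨G, hGm, hG0, hGi, hGb, hG⟩ :=
    exists_uniform_deviation hM hXY huv hNm hN hB hLipB hm hq hqm
  have hKne : (Finset.Icc 1 K).Nonempty := Finset.nonempty_Icc.2 hK
  set Z : Ω → ℝ := fun ω => (Finset.Icc 1 K).inf' hKne fun k => paramDist n ϑ (Θ k ω) with hZdef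
  have hZm : Measurable Z := measurable_inf_paramDist n ϑ hKne hΘ
  have hZ0 (ω : Ω) : 0 ≤ Z ω :=
    (Finset.le_inf'_iff hKne _).2 fun k _ => paramDist_nonneg _ _ _
  -- The initialisations lie in the small cube only almost surely, through their uniform law.
  have hae : ∀ᵐ ω ∂μ, ∀ k ∈ Set.Icc 1 K, Θ k ω ∈ cube dPar c :=
    (ae_ball_iff (Set.to_countable _)).2 fun k hk => ae_mem_cube hΘ hiid hunif hk
  have hZc : ∀ᵐ ω ∂μ, Z ω ≤ 2 * c := by
    filter_upwards [hae] with ω hω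
    refine (Finset.inf'_le _ (Finset.mem_Icc.2 ⟨le_rfl, hK⟩)).trans ?_
    refine (pi_norm_le_iff_of_nonneg (by positivity)).2 fun j => ?_
    have a1 := abs_le.1 (abs_param_le_of_mem_cube hc.le (hω 1 ⟨le_rfl, hK⟩) j)
    have a2 := abs_le.1 (abs_param_le_of_mem_cube hc.le hϑ j)
    exact abs_le.2 ⟨by linarith, by linarith⟩
  have hZi : Integrable (fun ω => Z ω ^ P) μ := integrable_rpow_of_bounded hP0.le hZm hZ0 hZc
  have hZb := integral_inf_paramDist_rpow_le hn1 hn hc hKne hΘ hiid hunif hϑ hP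
  have hGPi : Integrable (fun ω => G ω ^ P) μ := integrable_rpow_of_le hP0 hPq hGm hG0 hGi
  have hGPb : ∫ ω, G ω ^ P ∂μ ≤ (2 * ((v - u) ^ 2 / (2 * √M)) * √q) ^ P :=
    integral_rpow_le_of_le hP0 hPq (by positivity) hG0 hGi hGb
  set F : Ω → ℝ := fun ω => ∫ x, (NN (T ω) x - E x) ^ 2 ∂(μ.map (X 1)) with hFdef
  have hFm : Measurable F := by
    have h1 : Measurable fun z : Ω × S => (NN (T z.1) z.2 - E z.2) ^ 2 :=
      ((hNN.comp ((hT.comp measurable_fst).prodMk measurable_snd)).sub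
        (hE.comp measurable_snd)).pow_const 2
    exact (h1.stronglyMeasurable.integral_prod_right (ν := μ.map (X 1))).measurable
  have hF0 (ω : Ω) : 0 ≤ F ω := integral_nonneg fun x => sq_nonneg _
  have hFb (ω : Ω) : F ω ≤ (v - u) ^ 2 := by
    have := integral_mono_of_nonneg (μ := μ.map (X 1)) (ae_of_all _ fun x => sq_nonneg _)
      (integrable_const ((v - u) ^ 2))
      (ae_of_all _ fun x => (sq_sub_mem_Icc (hN (T ω) x) (hEb x)).2)
    simpa using this
  have hbv (θ : Fin dPar → ℝ) := integral_sq_sub_eq (μ := μ) hX1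
    (measurable_subtype_coe.comp hY1) hE (hNm θ) (fun ω => (Y 1 ω).2) hEb (hN θ) hcond
  -- Decomposition along `T ω`, the nearest initialisation `Θ k ω`, and `ϑ`. The deviation bound
  -- enters at `T ω` and at `ϑ`, hence the factors `8` and `2`; the common noise term of the two
  -- bias-variance identities cancels.
  have hFle : ∀ᵐ ω ∂μ, F ω ≤ (a + 8 * (v - u) * (ΛB * (B / m)))
      + 2 * (v - u) * Λc * Z ω + 2 * G ω := by
    filter_upwards [hae] with ω hω
    obtain ⟨k, hk, hZk⟩ := Finset.exists_mem_eq_inf' hKne fun k => paramDist n ϑ (Θ k ω)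
    have hk' : k ∈ Set.Icc 1 K := by simpa using hk
    have hϑB : ϑ ∈ cube dPar B := fun i =>
      ⟨by linarith [(hϑ i).1], (hϑ i).2.trans hcB⟩
    have e1 := abs_le.1 (hG ω (T ω) (hTB ω))
    have e2 := abs_le.1 (hG ω ϑ hϑB)
    have e3 := hmin ω k hk
    have e4 := abs_le.1 (abs_empRisk_sub_le hM X Y (hN (Θ k ω)) (hN ϑ) huv.le
      (hLipc _ (hω k hk') ϑ hϑ (Z ω) (hZ0 ω) fun j hj => by
        simp only [hZdef]
        rw [hZk]
        exact abs_param_sub_le_paramDist hj _ _) ω)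
    have e5 := hbv (T ω)
    have e6 := hbv ϑ
    have e7 : ∫ x, (NN ϑ x - E x) ^ 2 ∂(μ.map (X 1)) ≤ a := by
      have := integral_mono_of_nonneg (μ := μ.map (X 1)) (ae_of_all _ fun x => sq_nonneg _)
        (integrable_const a) (ae_of_all _ hϑa)
      simpa using this
    simp only [hFdef]
    simp only [Function.comp_apply] at e5 e6
    linarith [e1.1, e2.2, e4.2]
  have hfi : Integrable (fun ω => (2 * (v - u) * Λc * Z ω) ^ P) μ := by
    simp_rw [fun ω => Real.mul_rpow (z := P) (by positivity : 0 ≤ 2 * (v - u) * Λc) (hZ0 ω)]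
    exact hZi.const_mul _
  have hgi : Integrable (fun ω => (2 * G ω) ^ P) μ := by
    simp_rw [fun ω => Real.mul_rpow (z := P) (zero_le_two : (0 : ℝ) ≤ 2) (hG0 ω)]
    exact hGPi.const_mul _
  have hfb : ∫ ω, (2 * (v - u) * Λc * Z ω) ^ P ∂μ
      ≤ (2 * (v - u) * Λc * (P * (2 * c) * (K : ℝ) ^ (-(1 / (n : ℝ))))) ^ P := by
    simp_rw [fun ω => Real.mul_rpow (z := P) (by positivity : 0 ≤ 2 * (v - u) * Λc) (hZ0 ω)]
    rw [integral_const_mul, Real.mul_rpow (x := 2 * (v - u) * Λc) (by positivity) (by positivity)]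
    gcongr
  have hgb : ∫ ω, (2 * G ω) ^ P ∂μ ≤ (2 * (2 * ((v - u) ^ 2 / (2 * √M)) * √q)) ^ P := by
    simp_rw [fun ω => Real.mul_rpow (z := P) (zero_le_two : (0 : ℝ) ≤ 2) (hG0 ω)]
    rw [integral_const_mul, Real.mul_rpow (x := 2) (by positivity) (by positivity)]
    gcongr
  have hmink := integral_rpow_le_of_le_add (μ := μ) hP
    (a := a + 8 * (v - u) * (ΛB * (B / m))) (by positivity)
    (α := 2 * (v - u) * Λc * (P * (2 * c) * (K : ℝ) ^ (-(1 / (n : ℝ))))) (by positivity)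
    (β := 2 * (2 * ((v - u) ^ 2 / (2 * √M)) * √q)) (by positivity)
    hF0 (fun ω => mul_nonneg (by positivity) (hZ0 ω)) (fun ω => mul_nonneg zero_le_two (hG0 ω))
    hfi hgi hfb hgb hFle
  have hFi : Integrable (fun ω => F ω ^ P) μ :=
    integrable_rpow_of_bounded hP0.le hFm hF0 (ae_of_all _ hFb)
  -- Minkowski needs an exponent at least `1`; small `p` is reached from `P` by monotonicity of the
  -- norms.
  refine (integral_rpow_le_of_le hp hpP (by positivity) hF0 hFi hmink).trans_eq ?_
  congr 1
  ring

end Risk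

/-! ### Comparison of the explicit constants. -/

section Constants

lemma one_le_log_three_mul {x : ℝ} (hx : 1 ≤ x) : 1 ≤ Real.log (3 * x) := by
  rw [Real.le_log_iff_exp_le (by positivity)]
  linarith [Real.exp_one_lt_d9]

/-- This admits `q = (L A² T)²` as moment exponent, so that `√q` is the factor in the final
estimate. The point is `log m ≤ L A T`, from `m ≤ A^L (3MBb)^L`; one spare power of `A` and of `T`
absorbs the rest. -/
lemma log_mul_pow_le {L n m : ℕ} {A b B M T : ℝ} (hL : 1 ≤ L) (hA : 2 ≤ A) (hb : 1 ≤ b)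
    (hB : 1 ≤ B) (hM : 1 ≤ M) (hm : 1 ≤ m) (hm2 : (m : ℝ) ≤ 2 * (b * A ^ L * B ^ L * M))
    (hn : (n : ℝ) ≤ L * ((A - 1) * A)) (hT : Real.log (3 * M * B * b) ≤ T) :
    Real.log (2 * (m : ℝ) ^ n) ≤ (L * A ^ 2 * T) ^ 2 := by
  have hL1 : (1 : ℝ) ≤ L := by exact_mod_cast hL
  have hm0 : (1 : ℝ) ≤ m := by exact_mod_cast hm
  have hx : 1 ≤ M * B * b := one_le_mul_of_one_le_of_one_le (one_le_mul_of_one_le_of_one_le hM hB) hb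
  have hT1 : 1 ≤ T := by
    refine (one_le_log_three_mul hx).trans (le_trans (le_of_eq ?_) hT)
    congr 1; ring
  have h1 : Real.log m ≤ L * (A - 1) + L * T := by
    have h2 : (m : ℝ) ≤ A ^ L * (3 * M * B * b) ^ L := by
      have e1 : 2 * M ≤ (3 * M) ^ L :=
        (by linarith : 2 * M ≤ 3 * M).trans (le_self_pow₀ (by linarith) (by omega))
      have e2 : b ≤ b ^ L := le_self_pow₀ hb (by omega)
      calc (m : ℝ) ≤ 2 * (b * A ^ L * B ^ L * M) := hm2
        _ = A ^ L * ((2 * M) * B ^ L * b) := by ring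
        _ ≤ A ^ L * ((3 * M) ^ L * B ^ L * b ^ L) := by gcongr
        _ = _ := by rw [mul_pow (3 * M * B), mul_pow (3 * M)]
    calc Real.log m ≤ Real.log (A ^ L * (3 * M * B * b) ^ L) := Real.log_le_log (by linarith) h2
      _ = L * Real.log A + L * Real.log (3 * M * B * b) := by
        rw [Real.log_mul (by positivity) (by positivity), Real.log_pow, Real.log_pow]
      _ ≤ _ := by
        gcongr
        exact Real.log_le_sub_one_of_pos (by linarith)
  have h3 : Real.log 2 ≤ 1 := by linarith [Real.log_two_lt_d9]
  rw [Real.log_mul (by norm_num) (by positivity), Real.log_pow]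
  have h4 : (n : ℝ) * Real.log m ≤ L * ((A - 1) * A) * (L * (A * T)) := by
    refine mul_le_mul hn (h1.trans ?_) (Real.log_nonneg hm0) ?_
    · have : 0 ≤ (L : ℝ) * ((A - 1) * (T - 1)) :=
        mul_nonneg (by linarith) (mul_nonneg (by linarith) (by linarith))
      linarith
    · exact mul_nonneg (by linarith) (mul_nonneg (by linarith) (by linarith))
  have h5 : 1 ≤ (L : ℝ) ^ 2 * A ^ 2 * T :=
    one_le_mul_of_one_le_of_one_le (one_le_mul_of_one_le_of_one_le (one_le_pow₀ hL1)
      (one_le_pow₀ (by linarith))) hT1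
  calc Real.log 2 + n * Real.log m ≤ L ^ 2 * A ^ 2 * T + L * ((A - 1) * A) * (L * (A * T)) := by
        linarith
    _ = (L ^ 2 * A ^ 2 * T) * A := by ring
    _ ≤ (L ^ 2 * A ^ 2 * T) * (A ^ 2 * T) := by
        gcongr
        nlinarith
    _ = _ := by ring

/-- The lower bound on `m` makes the discretisation error at most a multiple of `L/M ≤ L/√M`. The
two contributions carry `8` and `2`, well below `18`. -/
lemma generalisation_constant_le {L m : ℕ} {A b B M T w q : ℝ} (hL : 1 ≤ L) (hA : 2 ≤ A)
    (hb : 1 ≤ b) (hB : 1 ≤ B) (hM : 1 ≤ M) (hw : 0 < w) (hm : 1 ≤ m)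
    (hm1 : b * A ^ L * B ^ L * M ≤ m) (hT1 : 1 ≤ T) (hq : q ≤ (L * A ^ 2 * T) ^ 2) :
    8 * w * (L * b * A ^ L * B ^ (L - 1) * (B / m)) + 2 * (2 * (w ^ 2 / (2 * √M)) * √q)
      ≤ 18 * max 1 (w ^ 2) * L * A ^ 2 * T / √M := by
  have hL1 : (1 : ℝ) ≤ L := by exact_mod_cast hL
  have hm0 : (1 : ℝ) ≤ m := by exact_mod_cast hm
  have hM0 : 0 < √M := Real.sqrt_pos.2 (by linarith)
  have hV : w ≤ max 1 (w ^ 2) := by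
    rcases le_total w 1 with h | h
    · exact h.trans (le_max_left _ _)
    · exact le_trans (by nlinarith) (le_max_right _ _)
  set V := max 1 (w ^ 2) with hVdef
  have hV0 : 0 < V := hw.trans_le hV
  have hLAT : (L : ℝ) ≤ L * A ^ 2 * T := by
    have : 1 ≤ A ^ 2 * T := one_le_mul_of_one_le_of_one_le (one_le_pow₀ (by linarith)) hT1
    nlinarith
  have hsq : √q ≤ L * A ^ 2 * T := (Real.sqrt_le_sqrt hq).trans_eq (Real.sqrt_sq (by positivity))
  have hBL : B ^ (L - 1) * B = B ^ L := pow_sub_one_mul (by omega) B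
  have h1 : b * A ^ L * B ^ L / m ≤ 1 / √M := by
    have hMM : √M ≤ M := by
      rw [Real.sqrt_le_left (by linarith)]
      nlinarith
    calc b * A ^ L * B ^ L / m ≤ 1 / M := by
          rw [div_le_div_iff₀ (by linarith) (by linarith)]
          linarith
      _ ≤ _ := by gcongr
  calc _ = 8 * w * L * (b * A ^ L * B ^ L / m) + 2 * w ^ 2 * √q * (1 / √M) := by
        rw [← hBL]; field_simp
    _ ≤ 8 * V * L * (1 / √M) + 2 * V * (L * A ^ 2 * T) * (1 / √M) := by
        gcongr
        exact le_max_right _ _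
    _ = V * (8 * L + 2 * (L * A ^ 2 * T)) / √M := by ring
    _ ≤ V * (18 * (L * A ^ 2 * T)) / √M := by
        gcongr
        linarith
    _ = _ := by ring

/-- The rate is weakened by `n ≤ L A (A-1) ≤ L A²`, and the factor `c` from the cube's diameter
completes `c^(L-1)` to `c^L`. -/
lemma optimisation_constant_le {L n K : ℕ} {A b c w P : ℝ} (hL : 1 ≤ L) (hA : 2 ≤ A)
    (hb : 1 ≤ b) (hc : 1 ≤ c) (hw : 0 < w) (hK : 1 ≤ K) (hP : 1 ≤ P) (hn1 : 1 ≤ n)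
    (hn : (n : ℝ) ≤ L * ((A - 1) * A)) :
    2 * w * (L * b * A ^ L * c ^ (L - 1)) * (P * (2 * c) * (K : ℝ) ^ (-(1 / (n : ℝ))))
      ≤ 4 * w * b * L * A ^ L * c ^ L * P / (K : ℝ) ^ ((L : ℝ)⁻¹ * (A ^ 2)⁻¹) := by
  have hL1 : (1 : ℝ) ≤ L := by exact_mod_cast hL
  have hK1 : (1 : ℝ) ≤ K := by exact_mod_cast hK
  have hn0 : (1 : ℝ) ≤ n := by exact_mod_cast hn1
  have hcL : c ^ (L - 1) * c = c ^ L := pow_sub_one_mul (by omega) c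
  have h1 : (K : ℝ) ^ (-(1 / (n : ℝ))) ≤ ((K : ℝ) ^ ((L : ℝ)⁻¹ * (A ^ 2)⁻¹))⁻¹ := by
    rw [← Real.rpow_neg (by positivity)]
    refine Real.rpow_le_rpow_of_exponent_le hK1 (neg_le_neg ?_)
    rw [← mul_inv, ← one_div]
    refine one_div_le_one_div_of_le (by linarith) (hn.trans ?_)
    gcongr
    nlinarith
  calc _ = 4 * w * b * L * A ^ L * c ^ L * P * (K : ℝ) ^ (-(1 / (n : ℝ))) := by
        rw [← hcL]; ring
    _ ≤ 4 * w * b * L * A ^ L * c ^ L * P * ((K : ℝ) ^ ((L : ℝ)⁻¹ * (A ^ 2)⁻¹))⁻¹ := by gcongr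
    _ = _ := (div_eq_mul_inv _ _).symm

/-- Here `20 = 2 + 18`: since `A ≥ 2`, `4 A^L ≤ 2 A^(L+1)`. The factor `B^L b` absorbs `B` and `b`
from the logarithm via `log(B b) ≤ B b - 1`. -/
lemma combined_constant_le {L : ℕ} {A b c B M w p κ : ℝ} (hL : 1 ≤ L) (hA : 2 ≤ A)
    (hb : 1 ≤ b) (hc : 1 ≤ c) (hcB : c ≤ B) (hM : 1 ≤ M) (hw : 0 < w) (hκ : 0 < κ) (hp : 0 < p) :
    4 * w * b * L * A ^ L * c ^ L * max 1 p / κ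
        + 18 * max 1 (w ^ 2) * L * A ^ 2 * max p (Real.log (3 * M * B * b)) / √M
      ≤ 20 * max 1 (w ^ 2) * b * L * A ^ (L + 1) * B ^ L * max p (Real.log (3 * M))
        / min (√M) κ := by
  have hL1 : (1 : ℝ) ≤ L := by exact_mod_cast hL
  have hB : 1 ≤ B := hc.trans hcB
  have hM0 : 0 < √M := Real.sqrt_pos.2 (by linarith)
  have hmin : 0 < min (√M) κ := lt_min hM0 hκ
  have hV : w ≤ max 1 (w ^ 2) := by
    rcases le_total w 1 with h | h
    · exact h.trans (le_max_left _ _)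
    · exact le_trans (by nlinarith) (le_max_right _ _)
  set V := max 1 (w ^ 2) with hVdef
  have hV0 : 0 < V := hw.trans_le hV
  have hlog : 1 ≤ Real.log (3 * M) := one_le_log_three_mul hM
  set T := max p (Real.log (3 * M)) with hT
  have hT1 : 1 ≤ T := hlog.trans (le_max_right _ _)
  have h1 : max 1 p ≤ T := max_le hT1 (le_max_left _ _)
  have hBL : B ≤ B ^ L := le_self_pow₀ hB (by omega)
  have hBb : 1 ≤ B ^ L * b := one_le_mul_of_one_le_of_one_le (one_le_pow₀ hB) hb
  have h2 : max p (Real.log (3 * M * B * b)) ≤ B ^ L * b * T := by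
    refine max_le ?_ ?_
    · have : p ≤ T := le_max_left _ _
      nlinarith
    · have e1 : Real.log (3 * M * B * b) = Real.log (3 * M) + Real.log (B * b) := by
        rw [mul_assoc, Real.log_mul (by positivity) (by positivity)]
      have e2 : Real.log (B * b) ≤ B * b - 1 := Real.log_le_sub_one_of_pos (by positivity)
      have e3 : Real.log (3 * M) ≤ T := le_max_right _ _
      have e4 : B * b ≤ B ^ L * b := by gcongr
      rw [e1]
      nlinarith
  have hA1 : 2 * A ^ L ≤ A ^ (L + 1) := by
    rw [pow_succ, mul_comm]
    gcongr
  have hA2 : A ^ 2 ≤ A ^ (L + 1) := pow_le_pow_right₀ (by linarith) (by omega)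
  calc _ ≤ 2 * V * b * L * (2 * A ^ L) * B ^ L * T / min (√M) κ
        + 18 * V * L * A ^ (L + 1) * (B ^ L * b * T) / min (√M) κ := by
        refine add_le_add ?_ ?_
        · calc _ ≤ 4 * V * b * L * A ^ L * B ^ L * T / min (√M) κ := by
                gcongr
                exact min_le_right _ _
            _ = _ := by ring
        · gcongr
          exact min_le_left _ _
    _ ≤ 2 * V * b * L * A ^ (L + 1) * B ^ L * T / min (√M) κ
        + 18 * V * L * A ^ (L + 1) * (B ^ L * b * T) / min (√M) κ := by gcongr
    _ = _ := by ring

end Constants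

end ClippedDNN

/-! ### The main estimate: measurability, choice of grid and exponents, conclusion. -/

theorem proposition5p3
    (d dPar L M K N : ℕ) (hd : 1 ≤ d) (hdPar : 1 ≤ dPar) (hL : 1 ≤ L) (hM : 1 ≤ M) (hK : 1 ≤ K)
    (hN : 1 ≤ N)
    (b c B u v : ℝ) (hb : 1 ≤ b) (hc : 1 ≤ c) (hB : c ≤ B) (huv : u < v)
    (l : Fin (L + 1) → ℕ) (hl : ∀ i, 1 ≤ l i)
    (NS : Set ℕ) (hNS : NS ⊆ Set.Icc 0 N) (h0NS : 0 ∈ NS)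
    (D : Set (Fin d → ℝ)) (hD : D ⊆ ClippedDNN.cube d b)
    (hl0 : l 0 = d) (hlL : l (Fin.last L) = 1)
    (hpar : ∑ i : Fin L, ClippedDNN.layerSize l i ≤ dPar)
    {Ω : Type*} [MeasurableSpace Ω] (μ : Measure Ω) [IsProbabilityMeasure μ]
    -- only the indices `j ≥ 1` are used
    (X : ℕ → Ω → D) (Y : ℕ → Ω → Set.Icc u v)
    (hXY : ClippedDNN.IsIIDOn (Set.Icc 1 M) (fun j ω => (X j ω, Y j ω)) μ)
    (E : D → Set.Icc u v) (hE : Measurable E)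
    (hEcond : (fun ω => (E (X 1 ω) : ℝ)) =ᵐ[μ]
      μ[fun ω => (Y 1 ω : ℝ) | MeasurableSpace.comap (X 1) inferInstance])
    (Θ : ℕ → ℕ → Ω → (Fin dPar → ℝ)) (hΘ : ∀ k n, Measurable (Θ k n))
    (kk : Ω → ℕ × ℕ) (hkk : Measurable kk)
    (hΘB : ∀ k, 1 ≤ k → ∀ ω, Θ k 0 ω ∈ ClippedDNN.cube dPar B)
    (hΘiid : ClippedDNN.IsIIDOn (Set.Icc 1 K) (fun k => Θ k 0) μ)
    (hΘunif : pdf.IsUniform (Θ 1 0) (ClippedDNN.cube dPar c) μ volume)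
    (R : (Fin dPar → ℝ) → Ω → ℝ)
    (hR : ∀ θ ω, R θ ω = (1 / (M : ℝ)) *
      ∑ j ∈ Finset.Icc 1 M, |ClippedDNN.realNN hl0 hlL u v θ (X j ω) - (Y j ω : ℝ)| ^ 2)
    (hmin : ∀ ω, kk ω ∈ ClippedDNN.argminOn
      {q : ℕ × ℕ | q.1 ∈ Set.Icc 1 K ∧ q.2 ∈ NS ∧ ‖Θ q.1 q.2 ω‖ ≤ B}
      (fun q => R (Θ q.1 q.2 ω) ω)) :
    -- the integrals in the estimate exist
    (∀ ω, Integrable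
      (fun x : D => |ClippedDNN.realNN hl0 hlL u v (Θ (kk ω).1 (kk ω).2 ω) x - (E x : ℝ)| ^ 2)
      (μ.map (X 1))) ∧
    ∀ p : ℝ, 0 < p →
      Integrable (fun ω =>
        (∫ x : D, |ClippedDNN.realNN hl0 hlL u v (Θ (kk ω).1 (kk ω).2 ω) x - (E x : ℝ)| ^ 2
          ∂(μ.map (X 1))) ^ p) μ ∧
      (∫ ω,
        (∫ x : D, |ClippedDNN.realNN hl0 hlL u v (Θ (kk ω).1 (kk ω).2 ω) x - (E x : ℝ)| ^ 2
          ∂(μ.map (X 1))) ^ p ∂μ) ^ (1 / p)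
        ≤ ClippedDNN.approxError D c
              (ClippedDNN.realNN (dPar := dPar) hl0 hlL u v) (fun x => (E x : ℝ))
          + 4 * (v - u) * b * L * (ClippedDNN.archNorm l + 1) ^ L * c ^ L * max 1 p
              / (K : ℝ) ^ ((L : ℝ)⁻¹ * ((ClippedDNN.archNorm l + 1) ^ 2)⁻¹)
          + 18 * max 1 ((v - u) ^ 2) * L * (ClippedDNN.archNorm l + 1) ^ 2
              * max p (Real.log (3 * M * B * b)) / Real.sqrt M ∧
      ClippedDNN.approxError D c
            (ClippedDNN.realNN (dPar := dPar) hl0 hlL u v) (fun x => (E x : ℝ))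
          + 4 * (v - u) * b * L * (ClippedDNN.archNorm l + 1) ^ L * c ^ L * max 1 p
              / (K : ℝ) ^ ((L : ℝ)⁻¹ * ((ClippedDNN.archNorm l + 1) ^ 2)⁻¹)
          + 18 * max 1 ((v - u) ^ 2) * L * (ClippedDNN.archNorm l + 1) ^ 2
              * max p (Real.log (3 * M * B * b)) / Real.sqrt M
        ≤ ClippedDNN.approxError D c
              (ClippedDNN.realNN (dPar := dPar) hl0 hlL u v) (fun x => (E x : ℝ))
          + 20 * max 1 ((v - u) ^ 2) * b * L * (ClippedDNN.archNorm l + 1) ^ (L + 1) * B ^ L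
              * max p (Real.log (3 * M))
            / min (Real.sqrt M)
                ((K : ℝ) ^ ((L : ℝ)⁻¹ * ((ClippedDNN.archNorm l + 1) ^ 2)⁻¹)) := by
  have h0M : (1 : ℕ) ∈ Set.Icc 1 M := ⟨le_rfl, hM⟩
  have hX1 : Measurable (X 1) := measurable_fst.comp (hXY.1 1 h0M)
  have : IsProbabilityMeasure (μ.map (X 1)) := Measure.isProbabilityMeasure_map hX1.aemeasurable
  set NN : (Fin dPar → ℝ) → D → ℝ := fun θ x => ClippedDNN.realNN hl0 hlL u v θ x with hNNdef
  have hNN : Measurable fun z : (Fin dPar → ℝ) × D => NN z.1 z.2 :=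
    (ClippedDNN.continuous_realNN hl0 hlL).measurable.comp
      (measurable_fst.prodMk (measurable_subtype_coe.comp measurable_snd))
  have hN (θ : Fin dPar → ℝ) (x : D) : NN θ x ∈ Set.Icc u v :=
    ClippedDNN.realNN_mem_Icc hL huv.le hl0 hlL θ x
  have hEm : Measurable fun x => (E x : ℝ) := measurable_subtype_coe.comp hE
  -- The random index takes countably many values, so the selected parameter is measurable.
  have hT : Measurable fun ω => Θ (kk ω).1 (kk ω).2 ω := by
    have h : Measurable fun z : (ℕ × ℕ) × Ω => Θ z.1.1 z.1.2 z.2 :=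
      measurable_from_prod_countable_right fun q => hΘ q.1 q.2
    exact h.comp (hkk.prodMk measurable_id)
  have hsq (θ : Fin dPar → ℝ) (x : D) : (NN θ x - E x) ^ 2 ∈ Set.Icc 0 ((v - u) ^ 2) :=
    ClippedDNN.sq_sub_mem_Icc (hN θ x) (E x).2
  have hinner (θ : Fin dPar → ℝ) :
      Integrable (fun x : D => (NN θ x - E x) ^ 2) (μ.map (X 1)) :=
    Integrable.of_mem_Icc 0 ((v - u) ^ 2)
      (((hNN.comp measurable_prodMk_left).sub hEm).pow_const 2).aemeasurable
      (ae_of_all _ fun x => hsq θ x)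
  simp only [sq_abs]
  refine ⟨fun ω => hinner _, fun p hp => ?_⟩
  set F : Ω → ℝ := fun ω =>
    ∫ x : D, (NN (Θ (kk ω).1 (kk ω).2 ω) x - E x) ^ 2 ∂(μ.map (X 1)) with hFdef
  have hF0 (ω : Ω) : 0 ≤ F ω := integral_nonneg fun x => sq_nonneg _
  have hFm : Measurable F := by
    have h1 : Measurable fun z : Ω × D => (NN (Θ (kk z.1).1 (kk z.1).2 z.1) z.2 - E z.2) ^ 2 :=
      ((hNN.comp ((hT.comp measurable_fst).prodMk measurable_snd)).sub
        (hEm.comp measurable_snd)).pow_const 2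
    exact (h1.stronglyMeasurable.integral_prod_right (ν := μ.map (X 1))).measurable
  have hFb (ω : Ω) : F ω ≤ (v - u) ^ 2 := by
    have := integral_mono (hinner (Θ (kk ω).1 (kk ω).2 ω)) (integrable_const ((v - u) ^ 2))
      fun x => (hsq _ x).2
    simpa using this
  have hw : 0 < v - u := sub_pos.2 huv
  have hB1 : 1 ≤ B := hc.trans hB
  have hM1 : (1 : ℝ) ≤ M := by exact_mod_cast hM
  have hK1 : (1 : ℝ) ≤ K := by exact_mod_cast hK
  have hA : 2 ≤ ClippedDNN.archNorm l + 1 := by linarith [ClippedDNN.one_le_archNorm hl]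
  have hn : ((∑ i, ClippedDNN.layerSize l i : ℕ) : ℝ)
      ≤ L * ((ClippedDNN.archNorm l + 1 - 1) * (ClippedDNN.archNorm l + 1)) := by
    rw [add_sub_cancel_right]
    exact ClippedDNN.sum_layerSize_le
  have hn1 : 1 ≤ ∑ i, ClippedDNN.layerSize l i := by
    refine le_trans ?_ (Finset.single_le_sum (fun i _ => Nat.zero_le _)
      (Finset.mem_univ (⟨0, hL⟩ : Fin L)))
    exact Nat.mul_pos (hl _) (Nat.succ_pos _)
  set A := ClippedDNN.archNorm l + 1 with hAdef
  refine ⟨ClippedDNN.integrable_rpow_of_bounded hp.le hFm hF0 (ae_of_all _ hFb), ?_, ?_⟩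
  · have hlog : 1 ≤ Real.log (3 * M * B * b) := by
      rw [mul_assoc, mul_assoc]
      exact ClippedDNN.one_le_log_three_mul (one_le_mul_of_one_le_of_one_le hM1
        (one_le_mul_of_one_le_of_one_le hB1 hb))
    set T := max p (Real.log (3 * M * B * b)) with hTdef
    have hT1 : 1 ≤ T := hlog.trans (le_max_right _ _)
    have hgrid : 1 ≤ b * A ^ L * B ^ L * M :=
      one_le_mul_of_one_le_of_one_le (one_le_mul_of_one_le_of_one_le
        (one_le_mul_of_one_le_of_one_le hb (one_le_pow₀ (by linarith))) (one_le_pow₀ hB1)) hM1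
    -- Rounding up at most doubles a number that is at least `1`.
    obtain ⟨m, hm1, hm2⟩ : ∃ m : ℕ, b * A ^ L * B ^ L * M ≤ m ∧
        (m : ℝ) ≤ 2 * (b * A ^ L * B ^ L * M) :=
      ⟨⌈b * A ^ L * B ^ L * M⌉₊, Nat.le_ceil _, by
        linarith [Nat.ceil_lt_add_one (zero_le_one.trans hgrid)]⟩
    have hm : 1 ≤ m := by exact_mod_cast hgrid.trans hm1
    have hq := ClippedDNN.log_mul_pow_le hL hA hb hB1 hM1 hm hm2 hn (le_max_right p _)
    rw [← hTdef] at hq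
    have hLAT : T ≤ L * A ^ 2 * T := by
      have hL1 : (1 : ℝ) ≤ L := by exact_mod_cast hL
      have : 1 ≤ (L : ℝ) * A ^ 2 :=
        one_le_mul_of_one_le_of_one_le hL1 (one_le_pow₀ (by linarith))
      nlinarith
    have hPq : max 1 p ≤ (L * A ^ 2 * T) ^ 2 := by
      have h1 : max 1 p ≤ L * A ^ 2 * T := (max_le hT1 (le_max_left _ _)).trans hLAT
      exact h1.trans (le_self_pow₀ (hT1.trans hLAT) two_ne_zero)
    have hgen := ClippedDNN.generalisation_constant_le hL hA hb hB1 hM1 hw hm hm1 hT1 le_rfl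
    have hopt := ClippedDNN.optimisation_constant_le hL hA hb hc hw hK (le_max_left 1 p) hn1 hn
    have hLip {r : ℝ} (hr : 1 ≤ r) : ∀ θ ∈ ClippedDNN.cube dPar r, ∀ ϑ ∈ ClippedDNN.cube dPar r,
        ∀ ε, 0 ≤ ε → (∀ j < ∑ i, ClippedDNN.layerSize l i,
          |ClippedDNN.param θ j - ClippedDNN.param ϑ j| ≤ ε) →
        ∀ x : D, |NN θ x - NN ϑ x| ≤ L * b * A ^ L * r ^ (L - 1) * ε :=
      fun θ hθ ϑ hϑ ε hε h x => ClippedDNN.abs_realNN_sub_le hl0 hlL hl hb hr hε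
        (fun j _ => ClippedDNN.abs_param_le_of_mem_cube (by linarith) hθ j)
        (fun j _ => ClippedDNN.abs_param_le_of_mem_cube (by linarith) hϑ j) h (hD x.2)
    have hL0 : (0 : ℝ) < L := by exact_mod_cast hL
    have hTB (ω : Ω) : Θ (kk ω).1 (kk ω).2 ω ∈ ClippedDNN.cube dPar B := fun i =>
      abs_le.1 ((norm_le_pi_norm _ i).trans (hmin ω).1.2.2)
    have hemp (ω : Ω) (k : ℕ) (hk : k ∈ Finset.Icc 1 K) :
        ClippedDNN.empRisk M X Y (NN (Θ (kk ω).1 (kk ω).2 ω)) ω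
          ≤ ClippedDNN.empRisk M X Y (NN (Θ k 0 ω)) ω := by
      have hk' : k ∈ Set.Icc 1 K := by simpa using hk
      have h := (hmin ω).2 (k, 0) ⟨hk', h0NS,
        (pi_norm_le_iff_of_nonneg (by linarith)).2 fun i => abs_le.2 (hΘB k hk'.1 ω i)⟩
      simpa only [hR, sq_abs, ClippedDNN.empRisk] using h
    have happ0 : 0 ≤ ClippedDNN.approxError D c
        (ClippedDNN.realNN (dPar := dPar) hl0 hlL u v) (fun x => (E x : ℝ)) :=
      Real.iInf_nonneg fun θ => Real.iSup_nonneg fun x => by positivity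
    -- The slack `ε` supplies a near-minimiser `ϑ` without attainment of the infimum, and keeps the
    -- constant in Minkowski's inequality positive even when the approximation error is `0`.
    refine le_of_forall_pos_le_add fun ε hε => ?_
    have : Nonempty (ClippedDNN.cube dPar c) := ⟨⟨0, fun i => ⟨by simp; linarith, by simp; linarith⟩⟩⟩
    obtain ⟨⟨ϑ, hϑ⟩, hϑε⟩ := exists_lt_of_ciInf_lt (lt_add_of_pos_right (ClippedDNN.approxError D c
      (ClippedDNN.realNN (dPar := dPar) hl0 hlL u v) (fun x => (E x : ℝ))) hε)
    have hϑa (x : D) : (NN ϑ x - E x) ^ 2 ≤ ClippedDNN.approxError D c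
        (ClippedDNN.realNN (dPar := dPar) hl0 hlL u v) (fun x => (E x : ℝ)) + ε := by
      refine le_trans ?_ hϑε.le
      rw [← sq_abs]
      -- A real supremum dominates its terms only if the family is bounded; clipping gives the bound
      -- `(v-u)²`.
      refine le_ciSup (f := fun x : D => |NN ϑ x - E x| ^ 2) ⟨(v - u) ^ 2, ?_⟩ x
      rintro _ ⟨y, rfl⟩
      simp only [sq_abs]
      exact (hsq ϑ y).2
    have hmain := ClippedDNN.integral_error_rpow_le hM hXY huv hNN hN hEm (fun x => (E x).2) hEcond
      (by linarith) hB (by positivity) (by positivity) (hLip hc) (hLip hB1) hn1 hpar hK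
      (fun k => hΘ k 0) hΘiid hΘunif hT hTB hemp hm hp (le_max_right 1 p) (le_max_left 1 p) hPq hq
      hϑ (add_pos_of_nonneg_of_pos happ0 hε) hϑa
    have hS : 0 ≤ ∫ ω, F ω ^ p ∂μ := integral_nonneg fun ω => Real.rpow_nonneg (hF0 ω) p
    have hroot := Real.rpow_le_rpow hS hmain (by positivity : 0 ≤ 1 / p)
    rw [← Real.rpow_mul (by positivity), mul_one_div_cancel hp.ne', Real.rpow_one] at hroot
    refine hroot.trans ?_
    linarith
  · rw [add_assoc]
    gcongr
    exact ClippedDNN.combined_constant_le hL hA hb hc hB hM1 hw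
      (Real.rpow_pos_of_pos (by linarith) _) hp
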